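/- Let $(k_n)_{n\ge 1}$ and $(d_n)_{n\ge 1}$ be sequences of positive integers with $k_n\to\infty$ and $d_n\gg k_n^2$, i.e. $k_n^2/d_n\to 0$, as $n\to\infty$. For each $n$ let $Z_1,\dots,Z_{k_n}$ be i.i.d. standard Gaussian vectors $N(0,I_{d_n})$ in $\mathbb R^{d_n}$. Then $$ d_{\mathrm{TV}}\left(\left(\frac{\langle Z_i,Z_j\rangle}{\|Z_i\|\,\|Z_j\|}\right)_{1\le i<j\le k_n},\ \left(\frac{\langle Z_i,Z_j\rangle}{d_n}\right)_{1\le i<j\le k_n}\right)\longrightarrow 0\qquad (n\to\infty), $$ where $\langle\cdot,\cdot\rangle$ and $\|\cdot\|$ are the Euclidean inner product and norm, and $d_{\mathrm{TV}}(X,Y)=\sup_A|\mathbb P(X\in A)-\mathbb P(Y\in A)|$, the supremum over Borel sets $A\subseteq\mathbb R^{\{(i,j):1\le i<j\le k_n\}}$, denotes the total variation distance between the laws of $X$ and $Y$. -/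

import Mathlib

open MeasureTheory ProbabilityTheory Filter Topology Asymptotics

noncomputable section

/-- The total variation distance `sup_A |μ(A) - ν(A)|` over measurable events `A`,
for probability measures `μ`, `ν` (the supremum is then over a set bounded by `1`). -/
def tvDist {α : Type*} [MeasurableSpace α] (μ ν : Measure α) : ℝ :=
  ⨆ A : {A : Set α // MeasurableSet A}, |μ.real A.1 - ν.real A.1|

/-- The pairs of indices `i < j` in a `k`-element index set. -/
abbrev UpperPairs (k : ℕ) : Type := {e : Fin k × Fin k // e.1 < e.2}

/-- The strictly upper triangular entries `⟨z i, z j⟩ / (‖z i‖ ‖z j‖)`, `i < j`, of the Gram matrix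
of the normalized vectors. -/
def sphericalGram {k d : ℕ} (z : Fin k → EuclideanSpace ℝ (Fin d)) : UpperPairs k → ℝ :=
  fun e => inner ℝ (z e.1.1) (z e.1.2) / (‖z e.1.1‖ * ‖z e.1.2‖)

/-- The strictly upper triangular entries `⟨z i, z j⟩ / d`, `i < j`, of the Gram matrix scaled by
the dimension. -/
def scaledGram {k d : ℕ} (z : Fin k → EuclideanSpace ℝ (Fin d)) : UpperPairs k → ℝ :=
  fun e => inner ℝ (z e.1.1) (z e.1.2) / (d : ℝ)

end

/-! The norm and the direction of a Gaussian vector are independent. So if ζ is an independent copy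
of Z, giving each Z i the norm of ζ i does not change the law (`measurePreserving_withNormOf`).
Hence the scaled Gram matrix has the law of the normalized one, X, with entry (i, j) multiplied by
exp (l i + l j), where l i = log (‖ζ i‖ / √d) is independent of X. It remains to see how sensitive
the law of X is to such row scalings.

Fix l, take a C¹ test function φ with values in [0, 1], and interpolate by the scalings with t • l,
0 ≤ t ≤ 1. The derivative in t of the expectation contains the derivatives of φ along the rows of X.
Integration by parts replaces each of them by φ times a score s i that does not depend on φ
(`integral_rowPart_eq`). So the expectations differ by at most E|∑ l i * s i|
(`abs_integral_scaleEntries_sub_le`).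

The score comes from conditioning on the other vectors. Let W be their span, of dimension m = k - 1,
and write Z i = a + b with a in W and b in Wᗮ. Only a enters the inner products with the others, so
dilating a dilates row i, at the speed B / (A + B) with A = ‖a‖², B = ‖b‖². The weight 1 + A / B
normalizes this speed to 1, and Gaussian integration by parts along the Euler field of W gives s i =
(1 + A / B)(A - m) - 2A / B. Since A is chi-square with only k - 1 degrees of freedom, E (s i)² =
O(k).

Finally E (l i)² = O(1/d), and E (l i * l j) = O(1/d²) for i ≠ j because the mean of l i is O(1/d).
Independence of l and s gives E (∑ l i * s i)² = ∑ E (l i * l j) E (s i * s j) = O(k²/d + k³/d²) =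
O(k²/d), and the L¹ norm is at most the L² norm. -/

/-! ### Density of the standard Gaussian measure -/

section Density

/-- The normalizing constant of the standard Gaussian density on `E`. -/
noncomputable def gaussianConst (E : Type*) [NormedAddCommGroup E] [InnerProductSpace ℝ E] : ℝ :=
  ((2 * Real.pi) ^ (Module.finrank ℝ E / 2 : ℝ))⁻¹

lemma gaussianConst_pos (E : Type*) [NormedAddCommGroup E] [InnerProductSpace ℝ E] :
    0 < gaussianConst E := by
  unfold gaussianConst; positivity

variable {E : Type*} [NormedAddCommGroup E] [InnerProductSpace ℝ E] [FiniteDimensional ℝ E]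
  [MeasurableSpace E] [BorelSpace E]

lemma integrable_exp_neg_sq_norm_div_two :
    Integrable (fun x : E => Real.exp (-‖x‖ ^ 2 / 2)) := by
  have h : (∫ x : E, Real.exp (-(1 / 2 : ℝ) * ‖x‖ ^ 2)) ≠ 0 := by
    rw [GaussianFourier.integral_rexp_neg_mul_sq_norm (by norm_num)]
    positivity
  have h2 := Integrable.of_integral_ne_zero h
  convert h2 using 3
  ring

/-- Both measures have the same characteristic function, by the Fourier transform of exp (-‖x‖² /
2). The density makes radial integrals and changes of variables available. -/
lemma stdGaussian_eq_withDensity :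
    stdGaussian E = volume.withDensity
      (fun x : E => ENNReal.ofReal (gaussianConst E * Real.exp (-‖x‖ ^ 2 / 2))) := by
  have hint : Integrable (fun x : E => gaussianConst E * Real.exp (-‖x‖ ^ 2 / 2)) :=
    integrable_exp_neg_sq_norm_div_two.const_mul _
  have : IsFiniteMeasure (volume.withDensity
      (fun x : E => ENNReal.ofReal (gaussianConst E * Real.exp (-‖x‖ ^ 2 / 2)))) :=
    isFiniteMeasure_withDensity_ofReal hint.2
  apply Measure.ext_of_charFun
  ext t
  rw [charFun_stdGaussian, charFun_apply,
    integral_withDensity_eq_integral_toReal_smul (by fun_prop) (by simp)]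
  have key := GaussianFourier.integral_cexp_neg_mul_sq_norm_add (V := E) (b := (1 / 2 : ℂ))
    (by norm_num) Complex.I t
  have : ∀ x : E, (ENNReal.ofReal (gaussianConst E * Real.exp (-‖x‖ ^ 2 / 2))).toReal •
      Complex.exp ((inner ℝ x t : ℝ) * Complex.I) = (gaussianConst E : ℂ) *
      Complex.exp (-(1 / 2 : ℂ) * ‖x‖ ^ 2 + Complex.I * (inner ℝ t x : ℝ)) := by
    intro x
    rw [ENNReal.toReal_ofReal (by have := gaussianConst_pos E; positivity), Complex.exp_add]
    rw [real_inner_comm, Complex.real_smul]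
    push_cast
    rw [mul_assoc]
    congr 3
    · ring
    · ring
  simp_rw [this]
  rw [integral_const_mul, key]
  have h1 : (gaussianConst E : ℂ) * ((Real.pi : ℂ) / (1 / 2)) ^ (Module.finrank ℝ E / 2 : ℂ) = 1 := by
    have : ((Real.pi : ℂ) / (1 / 2)) ^ (Module.finrank ℝ E / 2 : ℂ)
        = (((2 * Real.pi) ^ (Module.finrank ℝ E / 2 : ℝ) : ℝ) : ℂ) := by
      rw [Complex.ofReal_cpow (by positivity)]
      congr 1 <;> push_cast <;> ring
    rw [this, gaussianConst, ← Complex.ofReal_mul, inv_mul_cancel₀ (by positivity)]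
    simp
  rw [← mul_assoc, h1, one_mul]
  congr 1
  rw [Complex.I_sq]
  ring

lemma integral_stdGaussian (f : E → ℝ) :
    ∫ x, f x ∂(stdGaussian E) = gaussianConst E * ∫ x, Real.exp (-‖x‖ ^ 2 / 2) * f x := by
  rw [stdGaussian_eq_withDensity,
    integral_withDensity_eq_integral_toReal_smul (by fun_prop) (by simp), ← integral_const_mul]
  congr 1 with x
  rw [ENNReal.toReal_ofReal (by have := gaussianConst_pos E; positivity), smul_eq_mul, mul_assoc]

lemma integrable_stdGaussian_iff (f : E → ℝ) :
    Integrable f (stdGaussian E) ↔ Integrable (fun x => Real.exp (-‖x‖ ^ 2 / 2) * f x) := by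
  rw [stdGaussian_eq_withDensity,
    integrable_withDensity_iff_integrable_smul' (by fun_prop) (by simp),
    ← integrable_const_mul_iff (isUnit_iff_ne_zero.2 (gaussianConst_pos E).ne')
      (fun x => Real.exp (-‖x‖ ^ 2 / 2) * f x)]
  refine integrable_congr (ae_of_all _ fun x => ?_)
  beta_reduce
  rw [ENNReal.toReal_ofReal (by have := gaussianConst_pos E; positivity), smul_eq_mul, mul_assoc]

lemma stdGaussian_absolutelyContinuous : stdGaussian E ≪ volume := by
  rw [stdGaussian_eq_withDensity]
  exact withDensity_absolutelyContinuous _ _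

/-- Gives almost sure linear independence of the vectors and, with `W = ⊥`, that they do not vanish.
-/
lemma stdGaussian_submodule {W : Submodule ℝ E} (hW : W ≠ ⊤) : stdGaussian E W = 0 :=
  stdGaussian_absolutelyContinuous (Measure.addHaar_submodule _ _ hW)

end Density

/-! ### Positive and negative moments of the norm -/

section Moments

variable {E : Type*} [NormedAddCommGroup E] [InnerProductSpace ℝ E] [FiniteDimensional ℝ E]
  [MeasurableSpace E] [BorelSpace E] [Nontrivial E]

lemma integrable_norm_rpow_stdGaussian {s : ℝ} (hs : 0 < Module.finrank ℝ E + s) :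
    Integrable (fun x : E => ‖x‖ ^ s) (stdGaussian E) := by
  have hN : 0 < Module.finrank ℝ E := Module.finrank_pos
  rw [integrable_stdGaussian_iff]
  rw [integrable_fun_norm_addHaar (volume : Measure E) (f := fun r => Real.exp (-r ^ 2 / 2) * r ^ s)]
  have := integrableOn_rpow_mul_exp_neg_mul_sq (b := 1 / 2) (by norm_num)
    (s := Module.finrank ℝ E - 1 + s) (by linarith)
  refine this.congr_fun (fun y hy => ?_) measurableSet_Ioi
  have hy : 0 < y := hy
  simp only [smul_eq_mul]
  rw [Real.rpow_add hy, ← Nat.cast_pred hN, Real.rpow_natCast,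
    show -(1 / 2) * y ^ 2 = - y ^ 2 / 2 by ring]
  ring

variable (E) in
-- Polar coordinates reduce the moment to a Gamma integral. The constant is the same for all
-- exponents; only ratios of moments are needed, so its value is irrelevant.
lemma exists_integral_norm_rpow_stdGaussian :
    ∃ c : ℝ, ∀ s : ℝ, 0 < Module.finrank ℝ E + s →
      ∫ x : E, ‖x‖ ^ s ∂(stdGaussian E) =
        c * ((1 / 2 : ℝ) ^ (-(Module.finrank ℝ E + s) / 2)
          * Real.Gamma ((Module.finrank ℝ E + s) / 2)) := by
  have hN : 0 < Module.finrank ℝ E := Module.finrank_pos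
  refine ⟨gaussianConst E * (Module.finrank ℝ E * (volume : Measure E).real (Metric.ball 0 1)) / 2,
    fun s hs => ?_⟩
  rw [integral_stdGaussian]
  rw [integral_fun_norm_addHaar (volume : Measure E) (fun r => Real.exp (-r ^ 2 / 2) * r ^ s)]
  have := integral_rpow_mul_exp_neg_mul_rpow (p := 2) (b := 1 / 2)
    (q := Module.finrank ℝ E - 1 + s) (by norm_num) (by linarith) (by norm_num)
  have h2 : ∫ y in Set.Ioi (0 : ℝ), y ^ (Module.finrank ℝ E - 1) •
      (Real.exp (-y ^ 2 / 2) * y ^ s) = ∫ y in Set.Ioi (0 : ℝ),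
        y ^ (Module.finrank ℝ E - 1 + s : ℝ) * Real.exp (-(1 / 2) * y ^ (2 : ℝ)) := by
    refine setIntegral_congr_fun measurableSet_Ioi (fun y hy => ?_)
    have hy : 0 < y := hy
    simp only [smul_eq_mul]
    rw [Real.rpow_add hy, ← Nat.cast_pred hN, Real.rpow_natCast, Real.rpow_two,
      show -(1 / 2) * y ^ 2 = - y ^ 2 / 2 by ring]
    ring
  rw [h2, this]
  simp only [smul_eq_mul, nsmul_eq_mul]
  rw [show (Module.finrank ℝ E - 1 + s + 1 : ℝ) = Module.finrank ℝ E + s by ring]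
  ring

/-- This is Γ(x + 1) = x Γ(x). Negative `s` is allowed: from the zeroth moment 1, the recursion run
downwards yields the inverse moments. -/
lemma integral_norm_rpow_add_two_stdGaussian {s : ℝ} (hs : 0 < Module.finrank ℝ E + s) :
    ∫ x : E, ‖x‖ ^ (s + 2) ∂(stdGaussian E) =
      (Module.finrank ℝ E + s) * ∫ x : E, ‖x‖ ^ s ∂(stdGaussian E) := by
  obtain ⟨c, hc⟩ := exists_integral_norm_rpow_stdGaussian E
  rw [hc s hs, hc (s + 2) (by linarith)]
  rw [show (Module.finrank ℝ E + (s + 2) : ℝ) / 2 = (Module.finrank ℝ E + s) / 2 + 1 by ring,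
    Real.Gamma_add_one (by positivity),
    show -(Module.finrank ℝ E + (s + 2) : ℝ) / 2 = -(Module.finrank ℝ E + s) / 2 - 1 by ring,
    Real.rpow_sub_one (by norm_num)]
  ring

variable (E) in
lemma integral_norm_sq_stdGaussian :
    ∫ x : E, ‖x‖ ^ 2 ∂(stdGaussian E) = Module.finrank ℝ E := by
  have hN : (0 : ℝ) < Module.finrank ℝ E := Nat.cast_pos.2 Module.finrank_pos
  have h := integral_norm_rpow_add_two_stdGaussian (E := E) (s := 0) (by linarith)
  simpa using h

variable (E) in
lemma integral_norm_pow_add_two_stdGaussian (j : ℕ) :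
    ∫ x : E, ‖x‖ ^ (j + 2) ∂(stdGaussian E) =
      (Module.finrank ℝ E + j) * ∫ x : E, ‖x‖ ^ j ∂(stdGaussian E) := by
  have hN : (0 : ℝ) < Module.finrank ℝ E := Nat.cast_pos.2 Module.finrank_pos
  have h := integral_norm_rpow_add_two_stdGaussian (E := E) (s := j) (by positivity)
  simp_rw [Real.rpow_natCast] at h
  rw [← h]
  congr 1 with x
  rw [← Real.rpow_natCast]
  push_cast
  rfl

variable (E) in
lemma integrable_norm_pow_stdGaussian (j : ℕ) :
    Integrable (fun x : E => ‖x‖ ^ j) (stdGaussian E) := by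
  have hN : (0 : ℝ) < Module.finrank ℝ E := Nat.cast_pos.2 Module.finrank_pos
  have h := integrable_norm_rpow_stdGaussian (E := E) (s := j) (by positivity)
  simpa only [Real.rpow_natCast] using h

lemma integrable_inv_norm_pow_stdGaussian {j : ℕ} (hj : j < Module.finrank ℝ E) :
    Integrable (fun x : E => (‖x‖ ^ j)⁻¹) (stdGaussian E) := by
  have hj' : (j : ℝ) < Module.finrank ℝ E := by exact_mod_cast hj
  have h := integrable_norm_rpow_stdGaussian (E := E) (s := -j) (by linarith)
  simpa only [Real.rpow_neg (norm_nonneg _), Real.rpow_natCast] using h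

lemma integral_inv_norm_sq_stdGaussian (hN : 2 < Module.finrank ℝ E) :
    ∫ x : E, (‖x‖ ^ 2)⁻¹ ∂(stdGaussian E) = 1 / (Module.finrank ℝ E - 2) := by
  have hN' : (2 : ℝ) < Module.finrank ℝ E := by exact_mod_cast hN
  have h := integral_norm_rpow_add_two_stdGaussian (E := E) (s := -2) (by linarith)
  simp only [Real.rpow_neg (norm_nonneg _), Real.rpow_two, neg_add_cancel, Real.rpow_zero,
    integral_const, probReal_univ, smul_eq_mul, one_mul] at h
  rw [eq_div_iff (by linarith), h]
  ring

lemma integral_inv_norm_pow_four_stdGaussian (hN : 4 < Module.finrank ℝ E) :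
    ∫ x : E, (‖x‖ ^ 4)⁻¹ ∂(stdGaussian E) =
      1 / ((Module.finrank ℝ E - 2) * (Module.finrank ℝ E - 4)) := by
  have hN' : (4 : ℝ) < Module.finrank ℝ E := by exact_mod_cast hN
  have h := integral_norm_rpow_add_two_stdGaussian (E := E) (s := -4) (by linarith)
  rw [show (-4 + 2 : ℝ) = -2 by norm_num] at h
  have e4 : ∀ x : E, ‖x‖ ^ (-4 : ℝ) = (‖x‖ ^ 4)⁻¹ := fun x => by
    rw [Real.rpow_neg (norm_nonneg _)]; norm_cast
  simp only [Real.rpow_neg (norm_nonneg _) 2, Real.rpow_two, e4,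
    integral_inv_norm_sq_stdGaussian (by omega : 2 < Module.finrank ℝ E)] at h
  have h2 : (0 : ℝ) < Module.finrank ℝ E - 2 := by linarith
  have h4 : (0 : ℝ) < Module.finrank ℝ E - 4 := by linarith
  field_simp
  field_simp at h
  linarith

end Moments

/-! ### Polar coordinates; independence of norm and direction -/

section Polar

variable {E : Type*} [NormedAddCommGroup E] [InnerProductSpace ℝ E] [FiniteDimensional ℝ E]
  [MeasurableSpace E] [BorelSpace E]

lemma lintegral_polar (F : E → ENNReal) (hF : Measurable F) (hE : Nontrivial E) :
    ∫⁻ x, F x = ∫⁻ θ, ∫⁻ r, F (r.1 • θ.1)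
      ∂(Measure.volumeIoiPow (Module.finrank ℝ E - 1)) ∂(volume : Measure E).toSphere := by
  have hmp := (volume : Measure E).measurePreserving_homeomorphUnitSphereProd
  have h1 : ∫⁻ x, F x = ∫⁻ x : ({(0 : E)}ᶜ : Set E), F x ∂((volume : Measure E).comap (↑)) := by
    rw [lintegral_subtype_comap (measurableSet_singleton _).compl F, restrict_compl_singleton]
  rw [h1]
  have hg : Measurable (fun p : Metric.sphere (0 : E) 1 × Set.Ioi (0 : ℝ) =>
      F (p.2.1 • p.1.1)) := by fun_prop
  rw [← lintegral_prod _ hg.aemeasurable, ← hmp.lintegral_comp hg]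
  refine lintegral_congr fun x => ?_
  congr 1
  have hx : ‖(x : E)‖ ≠ 0 := norm_ne_zero_iff.2 x.2
  simp [smul_smul, hx]

lemma lintegral_stdGaussian (F : E → ENNReal) (hF : Measurable F) :
    ∫⁻ x, F x ∂(stdGaussian E) =
      ∫⁻ x, ENNReal.ofReal (gaussianConst E * Real.exp (-‖x‖ ^ 2 / 2)) * F x := by
  rw [stdGaussian_eq_withDensity, lintegral_withDensity_eq_lintegral_mul _ (by fun_prop) hF]
  rfl

lemma lintegral_stdGaussian_polar (hE : Nontrivial E) (F : E → ENNReal) (hF : Measurable F) :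
    ∫⁻ x, F x ∂(stdGaussian E) = ∫⁻ θ, ∫⁻ r,
      ENNReal.ofReal (gaussianConst E * Real.exp (-r.1 ^ 2 / 2)) * F (r.1 • θ.1)
      ∂(Measure.volumeIoiPow (Module.finrank ℝ E - 1)) ∂(volume : Measure E).toSphere := by
  rw [lintegral_stdGaussian F hF, lintegral_polar _ (by fun_prop) hE]
  refine lintegral_congr fun θ => lintegral_congr fun r => ?_
  have hr : 0 < r.1 := r.2
  have hθ : ‖θ.1‖ = 1 := by simp
  rw [norm_smul, hθ, mul_one, Real.norm_of_nonneg hr.le]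

/-- Replaces the norm of the second vector by the norm of the first one. -/
noncomputable def withNormOf (p : E × E) : E := (‖p.1‖ * ‖p.2‖⁻¹) • p.2

/-- The norm and the direction of a standard Gaussian vector are independent. -/
lemma measurePreserving_withNormOf [Nontrivial E] :
    MeasurePreserving (withNormOf (E := E)) ((stdGaussian E).prod (stdGaussian E))
      (stdGaussian E) := by
  have hmeas : Measurable (withNormOf (E := E)) := by unfold withNormOf; fun_prop
  refine ⟨hmeas, Measure.ext_of_lintegral _ fun F hF => ?_⟩
  have hE : Nontrivial E := inferInstance
  rw [lintegral_map hF hmeas, lintegral_prod _ (by fun_prop)]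
  set D : Set.Ioi (0 : ℝ) → ENNReal :=
    fun r => ENNReal.ofReal (gaussianConst E * Real.exp (-r.1 ^ 2 / 2)) with hD
  have hDm : Measurable D := by fun_prop
  set ν := Measure.volumeIoiPow (Module.finrank ℝ E - 1)
  set S := (volume : Measure E).toSphere
  set H : ℝ → ENNReal := fun r => ∫⁻ θ, F (r • θ.1) ∂S with hH
  have hHm : Measurable H := by
    have : Measurable (Function.uncurry fun (r : ℝ) (θ : Metric.sphere (0 : E) 1) =>
      F (r • θ.1)) := by simp only [Function.uncurry_def]; fun_prop
    exact this.lintegral_prod_right'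
  -- The radius of y cancels, so the inner integral depends on x only through ‖x‖ and the radial
  -- mass of y factors out.
  have hinner : ∀ x : E, ∫⁻ y, F (withNormOf (x, y)) ∂(stdGaussian E) =
      (∫⁻ r, D r ∂ν) * H ‖x‖ := by
    intro x
    rw [lintegral_stdGaussian_polar hE (fun y => F (withNormOf (x, y))) (by fun_prop), hH,
      mul_comm, ← lintegral_mul_const _ (by fun_prop)]
    refine lintegral_congr fun θ => ?_
    rw [mul_comm, ← lintegral_mul_const _ hDm]
    refine lintegral_congr fun r => ?_
    have hr : 0 < r.1 := r.2
    have hθ : ‖θ.1‖ = 1 := by simp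
    rw [hD, withNormOf, norm_smul, hθ, mul_one, Real.norm_of_nonneg hr.le, smul_smul,
      inv_mul_cancel_right₀ hr.ne']
  simp_rw [hinner]
  rw [lintegral_const_mul _ (by fun_prop), lintegral_stdGaussian_polar hE (fun x => H ‖x‖) (by fun_prop)]
  -- The total mass of the Gaussian measure in polar form; it removes both the sphere mass and the
  -- superfluous radial mass.
  have h1 : S Set.univ * ∫⁻ r, D r ∂ν = 1 := by
    have := lintegral_stdGaussian_polar hE (fun _ => 1) measurable_const
    simp only [lintegral_one, measure_univ, mul_one, lintegral_const] at this
    rw [this, mul_comm]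
  have h2 : ∀ θ : Metric.sphere (0 : E) 1, ∫⁻ r, D r * H ‖r.1 • θ.1‖ ∂ν = ∫⁻ r, D r * H r.1 ∂ν := by
    intro θ
    refine lintegral_congr fun r => ?_
    have hr : 0 < r.1 := r.2
    have hθ : ‖θ.1‖ = 1 := by simp
    rw [norm_smul, hθ, mul_one, Real.norm_of_nonneg hr.le]
  change (∫⁻ r, D r ∂ν) * ∫⁻ θ, ∫⁻ r, D r * H ‖r.1 • θ.1‖ ∂ν ∂S = _
  simp_rw [h2]
  rw [lintegral_const, mul_comm _ (S Set.univ), ← mul_assoc, mul_comm _ (S Set.univ), h1, one_mul,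
    lintegral_stdGaussian_polar hE F hF, lintegral_lintegral_swap]
  · refine lintegral_congr fun r => ?_
    rw [hH, lintegral_const_mul _ (by fun_prop)]
  · fun_prop

end Polar

/-! ### Gaussian integration by parts along rays -/

section Stein

variable {E : Type*} [NormedAddCommGroup E] [InnerProductSpace ℝ E] [FiniteDimensional ℝ E]
  [MeasurableSpace E] [BorelSpace E] [Nontrivial E]

variable (E) in
lemma integrable_exp_mul_norm_pow {b : ℝ} (hb : 0 < b) (j : ℕ) :
    Integrable (fun x : E => Real.exp (-b * ‖x‖ ^ 2) * ‖x‖ ^ j) := by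
  have hN : 0 < Module.finrank ℝ E := Module.finrank_pos
  rw [integrable_fun_norm_addHaar (volume : Measure E)
    (f := fun r => Real.exp (-b * r ^ 2) * r ^ j)]
  have := integrableOn_rpow_mul_exp_neg_mul_sq (b := b) hb (s := (Module.finrank ℝ E - 1 + j : ℕ))
    (by have : (0 : ℝ) ≤ (Module.finrank ℝ E - 1 + j : ℕ) := by positivity
        linarith)
  refine this.congr_fun (fun y hy => ?_) measurableSet_Ioi
  simp only [smul_eq_mul]
  rw [Real.rpow_natCast, pow_add]
  ring

/-- Gaussian integration by parts against the Euler vector field: `R` is the derivative of `G`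
along rays. -/
lemma integral_rayDeriv_stdGaussian {G R : E → ℝ} (hG : Measurable G) (hR : Measurable R) {C : ℝ}
    (hGb : ∀ a, |G a| ≤ C * (1 + ‖a‖ ^ 2)) (hRb : ∀ a, |R a| ≤ C * (1 + ‖a‖ ^ 2))
    (hGR : ∀ a, HasDerivAt (fun c : ℝ => G (c • a)) (R a) 1) :
    ∫ a, R a ∂(stdGaussian E) =
      ∫ a, G a * (‖a‖ ^ 2 - Module.finrank ℝ E) ∂(stdGaussian E) := by
  have hC : 0 ≤ C := by simpa using (abs_nonneg _).trans (hGb 0)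
  set N := Module.finrank ℝ E with hN
  have hray : ∀ a : E, ∀ c : ℝ, 0 < c → HasDerivAt (fun c : ℝ => G (c • a)) (R (c • a) / c) c := by
    intro a c hc
    have h1 : HasDerivAt (fun u : ℝ => u / c) (1 / c) c := (hasDerivAt_id c).div_const c
    have h2 := hGR (c • a)
    have h3 := HasDerivAt.comp (h₂ := fun u : ℝ => G (u • c • a)) c
      (by simpa [hc.ne'] using h2) h1
    rw [mul_one_div] at h3
    refine h3.congr_of_eventuallyEq (Eventually.of_forall fun u => ?_)
    simp only [Function.comp, smul_smul]
    rw [div_mul_cancel₀ _ hc.ne']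
  have hexp : ∀ b : ℝ, 0 < b → ∀ B : ℝ, Integrable (fun x : E =>
      Real.exp (-b * ‖x‖ ^ 2) * (B * (1 + ‖x‖ ^ 2) * (1 + ‖x‖ ^ 2))) := by
    intro b hb B
    have h0 := (integrable_exp_mul_norm_pow E hb 0).const_mul B
    have h2 := (integrable_exp_mul_norm_pow E hb 2).const_mul (2 * B)
    have h4 := (integrable_exp_mul_norm_pow E hb 4).const_mul B
    refine ((h0.add h2).add h4).congr (ae_of_all _ fun x => ?_)
    simp only [Pi.add_apply]
    ring
  -- A neighbourhood of 1 that stays away from 0.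
  set s : Set ℝ := Metric.ball 1 (1 / 2)
  have hs : s ∈ 𝓝 (1 : ℝ) := Metric.ball_mem_nhds _ (by norm_num)
  have hsb : ∀ c ∈ s, 1 / 2 < c ∧ c < 3 / 2 := by
    intro c hc
    rw [Metric.mem_ball, Real.dist_eq, abs_lt] at hc
    constructor <;> linarith [hc.1, hc.2]
  -- The integral of exp (-‖x‖² / 2) * G (c • x) is differentiated at c = 1 in two ways: directly,
  -- and after substituting x / c for x, which moves c onto the Gaussian. Only differentiability of
  -- G along rays is needed.
  have key1 : HasDerivAt (fun c : ℝ => ∫ x : E, Real.exp (-(1 / 2) * ‖x‖ ^ 2) * G (c • x))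
      (∫ x : E, Real.exp (-(1 / 2) * ‖x‖ ^ 2) * (R ((1 : ℝ) • x) / 1)) 1 := by
    refine (hasDerivAt_integral_of_dominated_loc_of_deriv_le (s := s)
      (F := fun c x => Real.exp (-(1 / 2) * ‖x‖ ^ 2) * G (c • x))
      (F' := fun c x => Real.exp (-(1 / 2) * ‖x‖ ^ 2) * (R (c • x) / c))
      (bound := fun x => Real.exp (-(1 / 2) * ‖x‖ ^ 2) *
        ((8 * C) * (1 + ‖x‖ ^ 2) * (1 + ‖x‖ ^ 2))) hs
      (Eventually.of_forall fun c => by fun_prop) ?_ (by fun_prop) ?_ ?_ ?_).2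
    · refine (hexp (1 / 2) (by norm_num) C).mono' (by fun_prop) (ae_of_all _ fun x => ?_)
      rw [norm_mul, Real.norm_of_nonneg (Real.exp_pos _).le, one_smul, Real.norm_eq_abs]
      gcongr
      refine (hGb x).trans (le_mul_of_one_le_right (by positivity) ?_)
      linarith [sq_nonneg ‖x‖]
    · refine ae_of_all _ fun x c hc => ?_
      obtain ⟨h1, h2⟩ := hsb c hc
      have hc0 : 0 < c := by linarith
      rw [norm_mul, Real.norm_of_nonneg (Real.exp_pos _).le, norm_div, Real.norm_of_nonneg hc0.le,
        Real.norm_eq_abs]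
      gcongr
      rw [div_le_iff₀ hc0]
      refine (hRb _).trans ?_
      rw [norm_smul, Real.norm_of_nonneg hc0.le, mul_pow]
      have hc2 : c ^ 2 ≤ 4 := by nlinarith
      have hx := sq_nonneg ‖x‖
      calc C * (1 + c ^ 2 * ‖x‖ ^ 2) ≤ C * (4 * (1 + ‖x‖ ^ 2)) := by gcongr; nlinarith
        _ = 8 * C * (1 + ‖x‖ ^ 2) * 1 * (1 / 2) := by ring
        _ ≤ 8 * C * (1 + ‖x‖ ^ 2) * (1 + ‖x‖ ^ 2) * c := by gcongr; linarith
    · exact hexp (1 / 2) (by norm_num) _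
    · refine ae_of_all _ fun x c hc => ?_
      exact (hray x c (by linarith [(hsb c hc).1])).const_mul _
  have key2 : HasDerivAt (fun c : ℝ => ∫ x : E, Real.exp (-(1 / 2) * (‖x‖ ^ 2 * (c ^ 2)⁻¹)) * G x)
      (∫ x : E, Real.exp (-(1 / 2) * (‖x‖ ^ 2 * ((1 : ℝ) ^ 2)⁻¹)) * (‖x‖ ^ 2 / 1 ^ 3) * G x) 1 := by
    refine (hasDerivAt_integral_of_dominated_loc_of_deriv_le (s := s)
      (F := fun c x => Real.exp (-(1 / 2) * (‖x‖ ^ 2 * (c ^ 2)⁻¹)) * G x)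
      (F' := fun c x => Real.exp (-(1 / 2) * (‖x‖ ^ 2 * (c ^ 2)⁻¹)) * (‖x‖ ^ 2 / c ^ 3) * G x)
      -- For 1/2 < c < 3/2, (c²)⁻¹ ≥ 1/4 gives the exponent 1/8 and (c³)⁻¹ ≤ 8 the factor 8.
      (bound := fun x => Real.exp (-(1 / 8) * ‖x‖ ^ 2) *
        ((8 * C) * (1 + ‖x‖ ^ 2) * (1 + ‖x‖ ^ 2))) hs
      (Eventually.of_forall fun c => by fun_prop) ?_ (by fun_prop) ?_ ?_ ?_).2
    · refine (hexp (1 / 2) (by norm_num) C).mono' (by fun_prop) (ae_of_all _ fun x => ?_)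
      rw [norm_mul, Real.norm_of_nonneg (Real.exp_pos _).le, Real.norm_eq_abs, one_pow, inv_one,
        mul_one]
      gcongr
      refine (hGb x).trans (le_mul_of_one_le_right (by positivity) ?_)
      linarith [sq_nonneg ‖x‖]
    · refine ae_of_all _ fun x c hc => ?_
      obtain ⟨h1, h2⟩ := hsb c hc
      have hc0 : 0 < c := by linarith
      rw [norm_mul, norm_mul, Real.norm_of_nonneg (Real.exp_pos _).le,
        Real.norm_of_nonneg (by positivity), Real.norm_eq_abs, mul_assoc]
      have hc2 : (1 / 4 : ℝ) ≤ (c ^ 2)⁻¹ := by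
        rw [one_div]
        apply inv_anti₀ (by positivity)
        nlinarith
      have hc3 : (c ^ 3)⁻¹ ≤ 8 := by
        rw [inv_le_comm₀ (by positivity) (by norm_num)]
        calc (8 : ℝ)⁻¹ = (1 / 2) ^ 3 := by norm_num
          _ ≤ c ^ 3 := by gcongr
      have hx := sq_nonneg ‖x‖
      refine mul_le_mul ?_ ?_ (by positivity) (Real.exp_pos _).le
      · apply Real.exp_le_exp.2
        nlinarith
      · calc ‖x‖ ^ 2 / c ^ 3 * |G x| = (c ^ 3)⁻¹ * ‖x‖ ^ 2 * |G x| := by ring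
          _ ≤ 8 * (1 + ‖x‖ ^ 2) * (C * (1 + ‖x‖ ^ 2)) := by
            gcongr
            · linarith
            · exact hGb x
          _ = _ := by ring
    · exact hexp (1 / 8) (by norm_num) _
    · refine ae_of_all _ fun x c hc => ?_
      have hc0 : c ≠ 0 := by linarith [(hsb c hc).1]
      have h1 : HasDerivAt (fun c : ℝ => -(1 / 2) * (‖x‖ ^ 2 * (c ^ 2)⁻¹)) (‖x‖ ^ 2 / c ^ 3) c := by
        have := (((hasDerivAt_pow 2 c).inv (pow_ne_zero 2 hc0)).const_mul (‖x‖ ^ 2)).const_mul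
          (-(1 / 2) : ℝ)
        refine this.congr_deriv ?_
        field_simp
        simp [mul_comm]
      exact h1.exp.mul_const _
  have key3 : HasDerivAt (fun c : ℝ => (c ^ N)⁻¹ *
      ∫ x : E, Real.exp (-(1 / 2) * (‖x‖ ^ 2 * (c ^ 2)⁻¹)) * G x)
      (∫ x : E, Real.exp (-(1 / 2) * ‖x‖ ^ 2) * (R ((1 : ℝ) • x) / 1)) 1 := by
    refine key1.congr_of_eventuallyEq ?_
    filter_upwards [hs] with c hc
    have hc0 : 0 < c := by linarith [(hsb c hc).1]
    have := Measure.integral_comp_smul_of_nonneg (volume : Measure E)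
      (fun x => Real.exp (-(1 / 2) * (‖x‖ ^ 2 * (c ^ 2)⁻¹)) * G x) c (hR := hc0.le)
    rw [smul_eq_mul, ← hN] at this
    rw [← this]
    congr 1 with x
    rw [norm_smul, Real.norm_of_nonneg hc0.le, mul_pow,
      show c ^ 2 * ‖x‖ ^ 2 * (c ^ 2)⁻¹ = ‖x‖ ^ 2 by field_simp]
  -- The Jacobian c⁻ᴺ contributes -N, the exponential ‖x‖².
  have key4 := ((hasDerivAt_pow N (1 : ℝ)).inv (by simp)).mul key2
  have := key3.unique key4
  simp only [one_smul, div_one, one_pow, inv_one, mul_one, Pi.inv_apply, one_mul] at this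
  have e : ∀ x : E, -‖x‖ ^ 2 / 2 = -(1 / 2) * ‖x‖ ^ 2 := fun x => by ring
  have I1 : Integrable (fun x : E => Real.exp (-(1 / 2) * ‖x‖ ^ 2) * ‖x‖ ^ 2 * G x) := by
    refine (hexp (1 / 2) (by norm_num) C).mono' (by fun_prop) (ae_of_all _ fun x => ?_)
    rw [norm_mul, Real.norm_of_nonneg (by positivity), Real.norm_eq_abs, mul_assoc]
    refine mul_le_mul_of_nonneg_left ?_ (Real.exp_pos _).le
    calc ‖x‖ ^ 2 * |G x| ≤ (1 + ‖x‖ ^ 2) * (C * (1 + ‖x‖ ^ 2)) := by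
          gcongr
          · linarith
          · exact hGb x
      _ = C * (1 + ‖x‖ ^ 2) * (1 + ‖x‖ ^ 2) := by ring
  have I2 : Integrable (fun x : E => Real.exp (-(1 / 2) * ‖x‖ ^ 2) * G x) := by
    refine (hexp (1 / 2) (by norm_num) C).mono' (by fun_prop) (ae_of_all _ fun x => ?_)
    rw [norm_mul, Real.norm_of_nonneg (by positivity), Real.norm_eq_abs]
    gcongr
    refine (hGb x).trans (le_mul_of_one_le_right (by positivity) ?_)
    linarith [sq_nonneg ‖x‖]
  rw [integral_stdGaussian, integral_stdGaussian]
  simp_rw [e]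
  rw [this, ← integral_const_mul, ← integral_add (I2.const_mul _) I1]
  congr 1
  refine integral_congr_ae (ae_of_all _ fun x => ?_)
  simp only
  ring

end Stein

/-! ### Orthogonal decomposition of a Gaussian vector -/

section Split

variable {E : Type*} [NormedAddCommGroup E] [InnerProductSpace ℝ E] [FiniteDimensional ℝ E]
  [MeasurableSpace E] [BorelSpace E]

/-- A standard Gaussian vector is the sum of independent standard Gaussian vectors in `W` and
its orthogonal complement. -/
lemma measurePreserving_add_orthogonal (W : Submodule ℝ E) :
    MeasurePreserving (fun p : W × Wᗮ => (p.1 : E) + (p.2 : E))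
      ((stdGaussian W).prod (stdGaussian Wᗮ)) (stdGaussian E) := by
  have hm : Measurable (fun p : W × Wᗮ => (p.1 : E) + (p.2 : E)) := by fun_prop
  refine ⟨hm, ?_⟩
  have : IsProbabilityMeasure (((stdGaussian W).prod (stdGaussian Wᗮ)).map
    (fun p : W × Wᗮ => (p.1 : E) + (p.2 : E))) := Measure.isProbabilityMeasure_map hm.aemeasurable
  apply Measure.ext_of_charFun
  ext t
  rw [charFun_apply, integral_map hm.aemeasurable (by fun_prop), charFun_stdGaussian]
  have h : ∀ p : W × Wᗮ, Complex.exp ((inner ℝ ((p.1 : E) + (p.2 : E)) t : ℝ) * Complex.I) =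
      Complex.exp ((inner ℝ p.1 (W.orthogonalProjectionOnto t) : ℝ) * Complex.I) *
      Complex.exp ((inner ℝ p.2 (Wᗮ.orthogonalProjectionOnto t) : ℝ) * Complex.I) := by
    intro p
    rw [← Complex.exp_add, ← add_mul, ← Complex.ofReal_add, inner_add_left,
      Submodule.inner_orthogonalProjectionOnto_eq_of_mem_left,
      Submodule.inner_orthogonalProjectionOnto_eq_of_mem_left]
  simp_rw [h]
  rw [integral_prod_mul (fun a : W => Complex.exp ((inner ℝ a (W.orthogonalProjectionOnto t) : ℝ) *
    Complex.I)) (fun b : Wᗮ => Complex.exp ((inner ℝ b (Wᗮ.orthogonalProjectionOnto t) : ℝ) *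
    Complex.I)), ← charFun_apply, ← charFun_apply, charFun_stdGaussian, charFun_stdGaussian,
    ← Complex.exp_add]
  congr 1
  have := Submodule.norm_sq_eq_add_norm_sq_projection t W
  rw [← Complex.ofReal_pow, ← Complex.ofReal_pow, ← Complex.ofReal_pow, this]
  push_cast
  ring

end Split

/-! ### Total variation through smooth test functions -/

section TotalVariation

open scoped ContDiff Manifold

/-- By regularity, an event A is squeezed by a compact K ⊆ A and an open U ⊇ K with A \ K and U \ K
of small mass; a smooth function equal to 1 on K and 0 off U then approximates the indicator of A.
-/
lemma tvDist_le_of_forall_contDiff {E : Type*} [NormedAddCommGroup E] [NormedSpace ℝ E]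
    [FiniteDimensional ℝ E] [MeasurableSpace E] [BorelSpace E] {μ ν : Measure E}
    [IsProbabilityMeasure μ] [IsProbabilityMeasure ν] {ε : ℝ}
    (h : ∀ φ : E → ℝ, ContDiff ℝ 1 φ → HasCompactSupport φ → (∀ x, 0 ≤ φ x ∧ φ x ≤ 1) →
      |∫ x, φ x ∂μ - ∫ x, φ x ∂ν| ≤ ε) : tvDist μ ν ≤ ε := by
  unfold tvDist
  have : Nonempty {A : Set E // MeasurableSet A} := ⟨⟨∅, MeasurableSet.empty⟩⟩
  refine ciSup_le fun ⟨A, hA⟩ => le_of_forall_pos_le_add fun δ hδ => ?_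
  -- With the sum, one choice of K and U serves both measures.
  set κ : Measure E := μ + ν with hκ
  have hfin : κ A ≠ ⊤ := measure_ne_top _ _
  obtain ⟨K, hKA, hK, hAK⟩ := hA.exists_isCompact_sdiff_lt hfin
    (ε := ENNReal.ofReal (δ / 2)) (by simpa using hδ)
  obtain ⟨U, hKU, hU, hUK⟩ := K.exists_isOpen_lt_add (μ := κ) (measure_ne_top _ _)
    (ε := ENNReal.ofReal (δ / 2)) (by simpa using hδ)
  obtain ⟨r, hr⟩ := hK.isBounded.subset_ball 0
  -- Intersecting U with a ball around K makes the support compact.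
  obtain ⟨f, hf0, hf1, hf⟩ := exists_contMDiffMap_zero_one_of_isClosed (n := 1) 𝓘(ℝ, E)
    (s := (U ∩ Metric.ball 0 r)ᶜ) (t := K) (hU.inter Metric.isOpen_ball).isClosed_compl
    hK.isClosed (Set.disjoint_left.2 fun x hx hxK => hx ⟨hKU hxK, hr hxK⟩)
  have hfd : ContDiff ℝ 1 f := f.contMDiff.contDiff
  have hfc : HasCompactSupport f := by
    refine HasCompactSupport.of_support_subset_isCompact (isCompact_closedBall (0 : E) r) ?_
    intro x hx
    by_contra hx'
    refine hx (hf0 (fun hxU => hx' (Metric.ball_subset_closedBall hxU.2)))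
  have hUKm : κ (U \ K) ≤ ENNReal.ofReal (δ / 2) := by
    rw [measure_sdiff hKU hK.measurableSet.nullMeasurableSet (measure_ne_top _ _)]
    exact tsub_le_iff_left.2 hUK.le
  have hbound : κ.real (A \ K) + κ.real (U \ K) ≤ δ := by
    have h1 : κ.real (A \ K) ≤ δ / 2 :=
      ENNReal.toReal_le_of_le_ofReal (by positivity) hAK.le
    have h2 : κ.real (U \ K) ≤ δ / 2 := ENNReal.toReal_le_of_le_ofReal (by positivity) hUKm
    linarith
  have hone : ∀ (ρ : Measure E) [IsProbabilityMeasure ρ],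
      |∫ x, f x ∂ρ - ρ.real A| ≤ ρ.real (A \ K) + ρ.real (U \ K) := by
    intro ρ _
    have hAKm : MeasurableSet (A \ K) := hA.diff hK.measurableSet
    have hUKm : MeasurableSet (U \ K) := hU.measurableSet.diff hK.measurableSet
    have If : Integrable f ρ := hfd.continuous.integrable_of_hasCompactSupport hfc
    have IA : Integrable (A.indicator (1 : E → ℝ)) ρ := (integrable_const 1).indicator hA
    have I1 : Integrable ((A \ K).indicator (1 : E → ℝ)) ρ := (integrable_const 1).indicator hAKm
    have I2 : Integrable ((U \ K).indicator (1 : E → ℝ)) ρ := (integrable_const 1).indicator hUKm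
    rw [← integral_indicator_one hA, ← integral_indicator_one hAKm, ← integral_indicator_one hUKm,
      ← integral_sub If IA, ← integral_add I1 I2]
    refine (abs_integral_le_integral_abs).trans (integral_mono (If.sub IA).abs (I1.add I2) ?_)
    intro x
    have hfx := hf x
    by_cases hxK : x ∈ K
    · have h1 : f x = 1 := hf1 hxK
      simp [h1, hKA hxK, hxK]
    · by_cases hxU : x ∈ U
      · by_cases hxA : x ∈ A <;> simp [hxK, hxU, hxA, abs_le] <;> constructor <;>
          linarith [hfx.1, hfx.2]
      · have h0 : f x = 0 := hf0 (fun hh => hxU hh.1)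
        by_cases hxA : x ∈ A <;> simp [hxK, hxU, hxA, h0]
  have hsum : ∀ s : Set E, κ.real s = μ.real s + ν.real s := fun s => by
    rw [hκ, measureReal_add_apply]
  have hm := hone μ
  have hn := hone ν
  have hh := h f hfd hfc hf
  rw [hsum, hsum] at hbound
  rw [abs_le] at *
  constructor <;> linarith [hm.1, hm.2, hn.1, hn.2, hh.1, hh.2]

end TotalVariation

/-! ### The row score and its second moment -/

/-- The score of the scaling of one row of the normalized Gram matrix, as a function of the squared
norms `A` and `B` of the components of the vector in the span of the other `m` vectors and in its
orthogonal complement. -/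
noncomputable def rowScore (m : ℕ) (A B : ℝ) : ℝ := (1 + A / B) * (A - m) - 2 * (A / B)

/-- The score equals (A - m) + A (A - m - 2) / B, and (x + y)² ≤ 2x² + 2y². In the bound A and B are
separated, ready for independence. -/
lemma rowScore_sq_le (m : ℕ) (A B : ℝ) :
    rowScore m A B ^ 2 ≤ 2 * (A - m) ^ 2 + 2 * (A ^ 2 * (A - m - 2) ^ 2 * (B ^ 2)⁻¹) := by
  have : rowScore m A B = (A - m) + A * (A - m - 2) * B⁻¹ := by
    unfold rowScore; rw [div_eq_mul_inv]; ring
  rw [this, ← inv_pow]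
  nlinarith [sq_nonneg ((A - m) - A * (A - m - 2) * B⁻¹)]

@[fun_prop]
lemma Measurable.rowScore {α : Type*} [MeasurableSpace α] {m : ℕ} {A B : α → ℝ}
    (hA : Measurable A) (hB : Measurable B) : Measurable (fun x => rowScore m (A x) (B x)) := by
  unfold _root_.rowScore; fun_prop

section SecondMoment

variable {E F : Type*} [NormedAddCommGroup E] [InnerProductSpace ℝ E] [FiniteDimensional ℝ E]
  [MeasurableSpace E] [BorelSpace E] [Nontrivial E] [NormedAddCommGroup F] [InnerProductSpace ℝ F]
  [FiniteDimensional ℝ F] [MeasurableSpace F] [BorelSpace F]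

/-- The leading term 4m is twice the variance 2m of a chi-square variable. The other uses E (B⁻²) =
1 / ((n - 2)(n - 4)), whence n > 4, and is also O(m) once n exceeds m comfortably. -/
lemma rowScore_second_moment {m n : ℕ} (hm : Module.finrank ℝ E = m)
    (hn : Module.finrank ℝ F = n) (hn4 : 4 < n) :
    Integrable (fun p : E × F => rowScore m (‖p.1‖ ^ 2) (‖p.2‖ ^ 2) ^ 2)
      ((stdGaussian E).prod (stdGaussian F)) ∧
    ∫ p : E × F, rowScore m (‖p.1‖ ^ 2) (‖p.2‖ ^ 2) ^ 2
      ∂((stdGaussian E).prod (stdGaussian F)) ≤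
      4 * m + 4 * (m * (m + 2) * (m + 6)) / ((n - 2) * (n - 4)) := by
  have : Nontrivial F := Module.nontrivial_of_finrank_pos (R := ℝ) (by omega)
  have P := integrable_norm_pow_stdGaussian E
  have M2 := integral_norm_sq_stdGaussian E
  have M4 := integral_norm_pow_add_two_stdGaussian E 2
  have M6 := integral_norm_pow_add_two_stdGaussian E 4
  have M8 := integral_norm_pow_add_two_stdGaussian E 6
  norm_num at M4 M6 M8
  rw [hm] at M2 M4 M6 M8
  rw [M2] at M4
  rw [M4] at M6
  rw [M6] at M8
  have I4 := integrable_inv_norm_pow_stdGaussian (E := F) (j := 4) (by omega)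
  have J4 := integral_inv_norm_pow_four_stdGaussian (E := F) (by omega)
  rw [hn] at J4
  have e1 : ∀ x : E, (‖x‖ ^ 2 - m) ^ 2 = ‖x‖ ^ 4 - 2 * m * ‖x‖ ^ 2 + m ^ 2 := fun x => by ring
  have e2 : ∀ x : E, (‖x‖ ^ 2) ^ 2 * (‖x‖ ^ 2 - m - 2) ^ 2 =
    ‖x‖ ^ 8 - 2 * (m + 2) * ‖x‖ ^ 6 + (m + 2) ^ 2 * ‖x‖ ^ 4 := fun x => by ring
  have A1 : Integrable (fun x : E => (‖x‖ ^ 2 - m) ^ 2) (stdGaussian E) := by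
    simp_rw [e1]
    exact ((P 4).sub ((P 2).const_mul _)).add (integrable_const _)
  have A2 : Integrable (fun x : E => (‖x‖ ^ 2) ^ 2 * (‖x‖ ^ 2 - m - 2) ^ 2) (stdGaussian E) := by
    simp_rw [e2]
    exact ((P 8).sub ((P 6).const_mul _)).add ((P 4).const_mul _)
  have V1 : ∫ x : E, (‖x‖ ^ 2 - m) ^ 2 ∂(stdGaussian E) = 2 * m := by
    simp_rw [e1]
    rw [integral_add (by exact (P 4).sub ((P 2).const_mul _)) (integrable_const _),
      integral_sub (P 4) ((P 2).const_mul _), integral_const_mul, M2, M4]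
    simp
    ring
  have V2 : ∫ x : E, (‖x‖ ^ 2) ^ 2 * (‖x‖ ^ 2 - m - 2) ^ 2 ∂(stdGaussian E)
      = 2 * ((m : ℝ) * (m + 2) * (m + 6)) := by
    simp_rw [e2]
    rw [integral_add (by exact (P 8).sub ((P 6).const_mul _)) ((P 4).const_mul _),
      integral_sub (P 8) ((P 6).const_mul _), integral_const_mul, integral_const_mul, M4, M6, M8]
    ring
  have I4' : Integrable (fun y : F => ((‖y‖ ^ 2) ^ 2)⁻¹) (stdGaussian F) := by
    simpa only [← pow_mul] using I4
  have J4' : ∫ y : F, ((‖y‖ ^ 2) ^ 2)⁻¹ ∂(stdGaussian F) = 1 / (((n : ℝ) - 2) * (n - 4)) := by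
    simpa only [← pow_mul] using J4
  have B1 : Integrable (fun p : E × F => 2 * (‖p.1‖ ^ 2 - m) ^ 2)
      ((stdGaussian E).prod (stdGaussian F)) := (A1.comp_fst _).const_mul 2
  have B2 : Integrable (fun p : E × F =>
      2 * ((‖p.1‖ ^ 2) ^ 2 * (‖p.1‖ ^ 2 - m - 2) ^ 2 * ((‖p.2‖ ^ 2) ^ 2)⁻¹))
      ((stdGaussian E).prod (stdGaussian F)) := (A2.mul_prod I4').const_mul 2
  have hle : ∀ p : E × F, rowScore m (‖p.1‖ ^ 2) (‖p.2‖ ^ 2) ^ 2 ≤ 2 * (‖p.1‖ ^ 2 - m) ^ 2 +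
      2 * ((‖p.1‖ ^ 2) ^ 2 * (‖p.1‖ ^ 2 - m - 2) ^ 2 * ((‖p.2‖ ^ 2) ^ 2)⁻¹) :=
    fun p => rowScore_sq_le _ _ _
  have hI : Integrable (fun p : E × F => rowScore m (‖p.1‖ ^ 2) (‖p.2‖ ^ 2) ^ 2)
      ((stdGaussian E).prod (stdGaussian F)) := by
    refine (B1.add B2).mono' (Measurable.aestronglyMeasurable (by fun_prop)) (ae_of_all _ fun p => ?_)
    rw [Real.norm_of_nonneg (sq_nonneg _)]
    exact hle p
  refine ⟨hI, (integral_mono hI (B1.add B2) hle).trans ?_⟩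
  simp only [Pi.add_apply]
  rw [integral_add B1 B2, integral_const_mul, integral_const_mul,
    integral_prod_mul (fun x : E => (‖x‖ ^ 2) ^ 2 * (‖x‖ ^ 2 - m - 2) ^ 2)
      (fun y : F => ((‖y‖ ^ 2) ^ 2)⁻¹), V2, J4', integral_fun_fst (fun x : E => (‖x‖ ^ 2 - m) ^ 2),
    V1]
  simp only [probReal_univ, one_smul]
  apply le_of_eq
  ring

end SecondMoment

/-! ### Dilating one vector inside the span of the others -/

section Row

/-- The number of times the index `i` occurs in the pair `e`. -/
def incidence {k : ℕ} (i : Fin k) (e : UpperPairs k) : ℝ :=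
  (if e.1.1 = i then 1 else 0) + (if e.1.2 = i then 1 else 0)

/-- The infinitesimal scaling of the entries of `x` whose index pair contains `i`. -/
def rowPart {k : ℕ} (i : Fin k) (x : UpperPairs k → ℝ) : UpperPairs k → ℝ :=
  fun e => incidence i e * x e

@[fun_prop]
lemma continuous_rowPart {k : ℕ} (i : Fin k) : Continuous (rowPart i) := by
  unfold rowPart; fun_prop

variable {k d : ℕ}

lemma measurable_sphericalGram :
    Measurable (sphericalGram : (Fin k → EuclideanSpace ℝ (Fin d)) → UpperPairs k → ℝ) := by
  unfold sphericalGram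
  fun_prop

/-- Scaling the component of the `i`-th vector in a subspace containing the other vectors scales the
`i`-th row of the normalized Gram matrix. -/
lemma sphericalGram_update_smul_add (z : Fin k → EuclideanSpace ℝ (Fin d)) (i : Fin k)
    (W : Submodule ℝ (EuclideanSpace ℝ (Fin d))) (hW : ∀ j, j ≠ i → z j ∈ W) (a : W) (b : Wᗮ)
    (c : ℝ) (h : (a : EuclideanSpace ℝ (Fin d)) + b ≠ 0) :
    sphericalGram (Function.update z i (((c • a : W) : EuclideanSpace ℝ (Fin d)) + b)) =
      sphericalGram (Function.update z i (a + b)) +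
        (c * (‖(a : EuclideanSpace ℝ (Fin d)) + b‖ *
          ‖((c • a : W) : EuclideanSpace ℝ (Fin d)) + b‖⁻¹) - 1) •
          rowPart i (sphericalGram (Function.update z i (a + b))) := by
  have hn : ‖(a : EuclideanSpace ℝ (Fin d)) + b‖ ≠ 0 := norm_ne_zero_iff.2 h
  have hb : ∀ j, j ≠ i → inner ℝ (b : EuclideanSpace ℝ (Fin d)) (z j) = 0 := fun j hj =>
    (Submodule.mem_orthogonal' _ _).1 b.2 _ (hW j hj)
  have hb' : ∀ j, j ≠ i → inner ℝ (z j) (b : EuclideanSpace ℝ (Fin d)) = 0 := fun j hj =>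
    (Submodule.mem_orthogonal _ _).1 b.2 _ (hW j hj)
  ext ⟨⟨p, q⟩, hpq⟩
  have hpq : p < q := hpq
  simp only [sphericalGram, rowPart, incidence, Pi.add_apply, Pi.smul_apply, smul_eq_mul]
  rcases eq_or_ne p i with rfl | hp
  · have hq : q ≠ p := hpq.ne'
    simp only [Function.update_self, Function.update_of_ne hq, if_true, if_neg hq, inner_add_left,
      hb q hq, Submodule.coe_smul, inner_smul_left, mul_inv, div_eq_mul_inv]
    field_simp
    simp
    ring
  · rcases eq_or_ne q i with rfl | hq
    · simp only [Function.update_self, Function.update_of_ne hp, if_true, if_neg hp,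
        inner_add_right, hb' p hp, Submodule.coe_smul, inner_smul_right, mul_inv, div_eq_mul_inv]
      field_simp
      simp
      ring
    · simp [hp, hq]

lemma sq_norm_coe_add_coe {W : Submodule ℝ (EuclideanSpace ℝ (Fin d))} (a : W) (b : Wᗮ) :
    ‖(a : EuclideanSpace ℝ (Fin d)) + b‖ ^ 2 = ‖a‖ ^ 2 + ‖b‖ ^ 2 := by
  have h : inner ℝ (a : EuclideanSpace ℝ (Fin d)) (b : EuclideanSpace ℝ (Fin d)) = 0 :=
    (Submodule.mem_orthogonal _ _).1 b.2 _ a.2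
  have := norm_add_sq_real (a : EuclideanSpace ℝ (Fin d)) (b : EuclideanSpace ℝ (Fin d))
  rw [this, h]
  simp

lemma coe_add_coe_ne_zero {W : Submodule ℝ (EuclideanSpace ℝ (Fin d))} (a : W) {b : Wᗮ}
    (hb : b ≠ 0) : (a : EuclideanSpace ℝ (Fin d)) + b ≠ 0 := by
  intro h
  have h1 := sq_norm_coe_add_coe a b
  rw [h] at h1
  have : 0 < ‖b‖ := norm_pos_iff.2 hb
  rw [norm_zero] at h1
  nlinarith [sq_nonneg ‖a‖]

/-- The ray derivative of the weighted test function used in the integration by parts. -/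
lemma hasDerivAt_weighted_sphericalGram (z : Fin k → EuclideanSpace ℝ (Fin d)) (i : Fin k)
    (W : Submodule ℝ (EuclideanSpace ℝ (Fin d))) (hW : ∀ j, j ≠ i → z j ∈ W)
    {φ : (UpperPairs k → ℝ) → ℝ} (hφ : ContDiff ℝ 1 φ) (a : W) {b : Wᗮ} (hb : b ≠ 0) :
    HasDerivAt (fun c : ℝ => (1 + ‖c • a‖ ^ 2 / ‖b‖ ^ 2) *
        φ (sphericalGram (Function.update z i (((c • a : W) : EuclideanSpace ℝ (Fin d)) + b))))
      (fderiv ℝ φ (sphericalGram (Function.update z i (a + b)))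
        (rowPart i (sphericalGram (Function.update z i (a + b)))) +
        2 * (‖a‖ ^ 2 / ‖b‖ ^ 2) * φ (sphericalGram (Function.update z i (a + b)))) 1 := by
  set x := sphericalGram (Function.update z i ((a : EuclideanSpace ℝ (Fin d)) + b)) with hx
  have hab := coe_add_coe_ne_zero a hb
  have hB : 0 < ‖b‖ := norm_pos_iff.2 hb
  simp_rw [fun c : ℝ => sphericalGram_update_smul_add z i W hW a b c hab]
  have hnorm : ∀ c : ℝ, ‖((c • a : W) : EuclideanSpace ℝ (Fin d)) + b‖ =
      Real.sqrt (c ^ 2 * ‖a‖ ^ 2 + ‖b‖ ^ 2) := by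
    intro c
    rw [eq_comm, Real.sqrt_eq_iff_eq_sq (by positivity) (norm_nonneg _), sq_norm_coe_add_coe,
      norm_smul, mul_pow, Real.norm_eq_abs, sq_abs]
  have hn1 : ‖(a : EuclideanSpace ℝ (Fin d)) + b‖ = Real.sqrt (‖a‖ ^ 2 + ‖b‖ ^ 2) := by
    simpa using hnorm 1
  simp_rw [hnorm, hn1, norm_smul, mul_pow, Real.norm_eq_abs, sq_abs]
  have hpos : 0 < ‖a‖ ^ 2 + ‖b‖ ^ 2 := by positivity
  set S := Real.sqrt (‖a‖ ^ 2 + ‖b‖ ^ 2) with hS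
  have hSpos : 0 < S := Real.sqrt_pos.2 hpos
  have hS2 : S ^ 2 = ‖a‖ ^ 2 + ‖b‖ ^ 2 := Real.sq_sqrt hpos.le
  have hq : HasDerivAt (fun c : ℝ => c ^ 2 * ‖a‖ ^ 2 + ‖b‖ ^ 2) (2 * ‖a‖ ^ 2) 1 := by
    simpa using ((hasDerivAt_pow 2 (1 : ℝ)).mul_const (‖a‖ ^ 2)).add_const (‖b‖ ^ 2)
  have hsq : HasDerivAt (fun c : ℝ => Real.sqrt (c ^ 2 * ‖a‖ ^ 2 + ‖b‖ ^ 2)) (‖a‖ ^ 2 / S) 1 := by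
    have := hq.sqrt (by simpa using hpos.ne')
    refine this.congr_deriv ?_
    simp only [one_pow, one_mul, ← hS]
    field_simp
  have hS1 : Real.sqrt (1 ^ 2 * ‖a‖ ^ 2 + ‖b‖ ^ 2) = S := by simp [hS]
  -- The speed ‖b‖² / (‖a‖² + ‖b‖²) is the inverse of the weight 1 + ‖a‖² / ‖b‖², so the weighted
  -- derivative of φ is exactly that along `rowPart`.
  have hκ : HasDerivAt (fun c : ℝ => c * (S * (Real.sqrt (c ^ 2 * ‖a‖ ^ 2 + ‖b‖ ^ 2))⁻¹) - 1)
      (‖b‖ ^ 2 / S ^ 2) 1 := by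
    have := (((hasDerivAt_id (1 : ℝ)).mul ((hsq.inv (by rw [hS1]; exact hSpos.ne')).const_mul
      S))).sub_const 1
    refine this.congr_deriv ?_
    simp only [id, Pi.inv_apply, hS1]
    have : ‖b‖ ^ 2 = S ^ 2 - ‖a‖ ^ 2 := by rw [hS2]; ring
    rw [this]
    field_simp
    ring
  have hw : HasDerivAt (fun c : ℝ => 1 + c ^ 2 * ‖a‖ ^ 2 / ‖b‖ ^ 2) (2 * (‖a‖ ^ 2 / ‖b‖ ^ 2)) 1 := by
    have := (((hasDerivAt_pow 2 (1 : ℝ)).mul_const (‖a‖ ^ 2)).div_const (‖b‖ ^ 2)).const_add 1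
    refine this.congr_deriv ?_
    norm_num
    ring
  have hcurve : HasDerivAt (fun c : ℝ =>
      x + (c * (S * (Real.sqrt (c ^ 2 * ‖a‖ ^ 2 + ‖b‖ ^ 2))⁻¹) - 1) • rowPart i x)
      ((‖b‖ ^ 2 / S ^ 2) • rowPart i x) 1 := (hκ.smul_const (rowPart i x)).const_add x
  have hx1 : x + ((1 : ℝ) * (S * (Real.sqrt ((1 : ℝ) ^ 2 * ‖a‖ ^ 2 + ‖b‖ ^ 2))⁻¹) - 1) •
      rowPart i x = x := by
    rw [hS1, mul_inv_cancel₀ hSpos.ne']; simp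
  have hφx : HasFDerivAt φ (fderiv ℝ φ x)
      (x + ((1 : ℝ) * (S * (Real.sqrt ((1 : ℝ) ^ 2 * ‖a‖ ^ 2 + ‖b‖ ^ 2))⁻¹) - 1) • rowPart i x) := by
    rw [hx1]
    exact (hφ.differentiable (by norm_num)).differentiableAt.hasFDerivAt
  have hfin := hw.mul (hφx.comp_hasDerivAt (1 : ℝ) hcurve)
  refine hfin.congr_deriv ?_
  simp only [Function.comp, hx1, map_smul, smul_eq_mul]
  rw [hS2]
  field_simp
  ring

end Row

/-! ### Integration by parts for one row, the other vectors fixed -/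

section RowIdentity

variable {k d : ℕ}

/-- Integration by parts in a, with b frozen, for the weighted test function; the derivative of the
weight goes to the other side as the term -2A / B of the score. -/
lemma rowScore_identity_fiber (z : Fin k → EuclideanSpace ℝ (Fin d)) (i : Fin k)
    (W : Submodule ℝ (EuclideanSpace ℝ (Fin d))) (hW : ∀ j, j ≠ i → z j ∈ W)
    {m : ℕ} (hm : Module.finrank ℝ W = m) (hm0 : 0 < m)
    {φ : (UpperPairs k → ℝ) → ℝ} (hφ : ContDiff ℝ 1 φ) {C : ℝ} (hφb : ∀ x, |φ x| ≤ C)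
    (hφb' : ∀ x, |fderiv ℝ φ x (rowPart i x)| ≤ C) {b : Wᗮ} (hb : b ≠ 0) :
    ∫ a : W, fderiv ℝ φ (sphericalGram (Function.update z i (a + b)))
        (rowPart i (sphericalGram (Function.update z i (a + b)))) ∂(stdGaussian W) =
    ∫ a : W, φ (sphericalGram (Function.update z i (a + b))) *
        rowScore m (‖a‖ ^ 2) (‖b‖ ^ 2) ∂(stdGaussian W) := by
  have hWn : Nontrivial W := Module.nontrivial_of_finrank_pos (R := ℝ) (by omega)
  have hC : 0 ≤ C := (abs_nonneg _).trans (hφb 0)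
  have hφc : Continuous φ := hφ.continuous
  have hφ'c : Continuous (fun x => fderiv ℝ φ x (rowPart i x)) :=
    (hφ.continuous_fderiv (by norm_num)).clm_apply (continuous_rowPart i)
  have hB : 0 < ‖b‖ := norm_pos_iff.2 hb
  have hXb : Measurable (fun a : W => sphericalGram
      (Function.update z i ((a : EuclideanSpace ℝ (Fin d)) + b))) :=
    measurable_sphericalGram.comp ((measurable_update z).comp (by fun_prop))
  set X : W → UpperPairs k → ℝ := fun a => sphericalGram
      (Function.update z i ((a : EuclideanSpace ℝ (Fin d)) + b)) with hXdef
  have hφX : Measurable (fun a => φ (X a)) := hφc.measurable.comp hXb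
  have hφ'X : Measurable (fun a => fderiv ℝ φ (X a) (rowPart i (X a))) := hφ'c.measurable.comp hXb
  set β := (‖b‖ ^ 2)⁻¹ with hβ
  have hβ0 : 0 ≤ β := by positivity
  have key := integral_rayDeriv_stdGaussian (E := W)
    (G := fun a => (1 + ‖a‖ ^ 2 / ‖b‖ ^ 2) * φ (X a))
    (R := fun a => fderiv ℝ φ (X a) (rowPart i (X a)) + 2 * (‖a‖ ^ 2 / ‖b‖ ^ 2) * φ (X a))
    (by fun_prop) (by fun_prop) (C := C * (1 + 2 * β)) ?_ ?_
    (fun a => hasDerivAt_weighted_sphericalGram z i W hW hφ a hb)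
  · have P := integrable_norm_pow_stdGaussian W
    have J1 : Integrable (fun a => fderiv ℝ φ (X a) (rowPart i (X a))) (stdGaussian W) :=
      Integrable.of_bound hφ'X.aestronglyMeasurable C (ae_of_all _ fun a => hφb' _)
    have J2 : Integrable (fun a => 2 * (‖a‖ ^ 2 / ‖b‖ ^ 2) * φ (X a)) (stdGaussian W) :=
      (((P 2).div_const _).const_mul 2).mul_bdd hφX.aestronglyMeasurable
        (ae_of_all _ fun a => hφb _)
    have J3 : Integrable (fun a => (1 + ‖a‖ ^ 2 / ‖b‖ ^ 2) * φ (X a) *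
        (‖a‖ ^ 2 - Module.finrank ℝ W)) (stdGaussian W) := by
      have : Integrable (fun a : W => (1 + ‖a‖ ^ 2 / ‖b‖ ^ 2) * (‖a‖ ^ 2 - Module.finrank ℝ W))
          (stdGaussian W) := by
        refine ((((P 2).sub (integrable_const (Module.finrank ℝ W : ℝ)))).add
          (((P 4).sub ((P 2).const_mul (Module.finrank ℝ W : ℝ))).mul_const β)).congr
          (ae_of_all _ fun a => ?_)
        simp only [Pi.add_apply, Pi.sub_apply, hβ, div_eq_mul_inv]
        ring
      refine (this.mul_bdd hφX.aestronglyMeasurable (ae_of_all _ fun a => hφb _)).congr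
        (ae_of_all _ fun a => ?_)
      simp only
      ring
    rw [integral_add J1 J2] at key
    rw [eq_sub_of_add_eq key, ← integral_sub J3 J2]
    refine integral_congr_ae (ae_of_all _ fun a => ?_)
    simp only [rowScore, hm]
    ring
  · intro a
    rw [abs_mul, abs_of_nonneg (by positivity), div_eq_mul_inv, ← hβ]
    have h1 := hφb (X a)
    have h2 := sq_nonneg ‖a‖
    calc (1 + ‖a‖ ^ 2 * β) * |φ (X a)| ≤ (1 + ‖a‖ ^ 2 * β) * C := by gcongr
      _ ≤ C * (1 + 2 * β) * (1 + ‖a‖ ^ 2) := by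
        nlinarith [mul_nonneg hC hβ0, mul_nonneg (mul_nonneg hC hβ0) h2, mul_nonneg hC h2]
  · intro a
    refine (abs_add_le _ _).trans ?_
    rw [abs_mul, abs_of_nonneg (by positivity : 0 ≤ 2 * (‖a‖ ^ 2 / ‖b‖ ^ 2)), div_eq_mul_inv, ← hβ]
    have h1 := hφb (X a)
    have h3 := hφb' (X a)
    have h2 := sq_nonneg ‖a‖
    calc |fderiv ℝ φ (X a) (rowPart i (X a))| + 2 * (‖a‖ ^ 2 * β) * |φ (X a)| ≤
        C + 2 * (‖a‖ ^ 2 * β) * C := by gcongr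
      _ ≤ C * (1 + 2 * β) * (1 + ‖a‖ ^ 2) := by
        nlinarith [mul_nonneg hC hβ0, mul_nonneg (mul_nonneg hC hβ0) h2, mul_nonneg hC h2]

/-- The fibre identity integrated over b. Codimension above 4 makes the score square integrable,
which justifies Fubini. -/
lemma rowScore_identity_split (z : Fin k → EuclideanSpace ℝ (Fin d)) (i : Fin k)
    (W : Submodule ℝ (EuclideanSpace ℝ (Fin d))) (hW : ∀ j, j ≠ i → z j ∈ W)
    {m : ℕ} (hm : Module.finrank ℝ W = m) (hm0 : 0 < m) (hn : 4 < Module.finrank ℝ Wᗮ)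
    {φ : (UpperPairs k → ℝ) → ℝ} (hφ : ContDiff ℝ 1 φ) {C : ℝ} (hφb : ∀ x, |φ x| ≤ C)
    (hφb' : ∀ x, |fderiv ℝ φ x (rowPart i x)| ≤ C) :
    ∫ p : W × Wᗮ, fderiv ℝ φ (sphericalGram (Function.update z i (p.1 + p.2)))
        (rowPart i (sphericalGram (Function.update z i (p.1 + p.2))))
        ∂((stdGaussian W).prod (stdGaussian Wᗮ)) =
    ∫ p : W × Wᗮ, φ (sphericalGram (Function.update z i (p.1 + p.2))) *
        rowScore m (‖p.1‖ ^ 2) (‖p.2‖ ^ 2) ∂((stdGaussian W).prod (stdGaussian Wᗮ)) := by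
  have hWn : Nontrivial W := Module.nontrivial_of_finrank_pos (R := ℝ) (by omega)
  have hC : 0 ≤ C := (abs_nonneg _).trans (hφb 0)
  have hφc : Continuous φ := hφ.continuous
  have hφ'c : Continuous (fun x => fderiv ℝ φ x (rowPart i x)) :=
    (hφ.continuous_fderiv (by norm_num)).clm_apply (continuous_rowPart i)
  have hX : Measurable (fun p : W × Wᗮ => sphericalGram
      (Function.update z i ((p.1 : EuclideanSpace ℝ (Fin d)) + p.2))) :=
    measurable_sphericalGram.comp ((measurable_update z).comp (by fun_prop))
  have hsq := (rowScore_second_moment (E := W) (F := Wᗮ) hm rfl hn).1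
  have hscore : Integrable (fun p : W × Wᗮ => rowScore m (‖p.1‖ ^ 2) (‖p.2‖ ^ 2))
      ((stdGaussian W).prod (stdGaussian Wᗮ)) := by
    refine (hsq.add (integrable_const 1)).mono' (Measurable.aestronglyMeasurable (by fun_prop))
      (ae_of_all _ fun p => ?_)
    have habs : ∀ s : ℝ, |s| ≤ s ^ 2 + 1 := fun s =>
      abs_le.2 ⟨by nlinarith [sq_nonneg (s + 1)], by nlinarith [sq_nonneg (s - 1)]⟩
    exact habs _
  have hI2 : Integrable (fun p : W × Wᗮ =>
      φ (sphericalGram (Function.update z i (p.1 + p.2))) * rowScore m (‖p.1‖ ^ 2) (‖p.2‖ ^ 2))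
      ((stdGaussian W).prod (stdGaussian Wᗮ)) :=
    hscore.bdd_mul (hφc.measurable.comp hX).aestronglyMeasurable (ae_of_all _ fun p => hφb _)
  have hI1 : Integrable (fun p : W × Wᗮ =>
      fderiv ℝ φ (sphericalGram (Function.update z i (p.1 + p.2)))
        (rowPart i (sphericalGram (Function.update z i (p.1 + p.2)))))
      ((stdGaussian W).prod (stdGaussian Wᗮ)) :=
    Integrable.of_bound (hφ'c.measurable.comp hX).aestronglyMeasurable C
      (ae_of_all _ fun p => hφb' _)
  rw [integral_prod_symm _ hI1, integral_prod_symm _ hI2]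
  have hb0 : ∀ᵐ b : Wᗮ ∂(stdGaussian Wᗮ), b ≠ 0 := by
    have : Nontrivial Wᗮ := Module.nontrivial_of_finrank_pos (R := ℝ) (by omega)
    have h := stdGaussian_submodule (E := Wᗮ) (W := ⊥) bot_ne_top
    simpa [ae_iff] using h
  refine integral_congr_ae ?_
  filter_upwards [hb0] with b hb
  exact rowScore_identity_fiber z i W hW hm hm0 hφ hφb hφb' hb

end RowIdentity

/-! ### Distance to the span of the other vectors -/

section DistOthers

variable {k : ℕ} {H : Type*} [NormedAddCommGroup H] [InnerProductSpace ℝ H]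

/-- The distance of the `i`-th vector to the span of the other ones. -/
noncomputable def distOthers (i : Fin k) (z : Fin k → H) : ℝ :=
  ⨅ c : Fin k → ℝ, ‖z i - ∑ j ∈ Finset.univ.erase i, c j • z j‖

/-- The span of all vectors but the `i`-th one. -/
def spanOthers (i : Fin k) (z : Fin k → H) : Submodule ℝ H := Submodule.span ℝ (z '' {i}ᶜ)

lemma spanOthers_update (i : Fin k) (z : Fin k → H) (w : H) :
    spanOthers i (Function.update z i w) = spanOthers i z := by
  unfold spanOthers
  congr 1
  refine Set.image_congr fun j hj => ?_
  exact Function.update_of_ne hj _ _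

lemma mem_spanOthers {i j : Fin k} (z : Fin k → H) (hj : j ≠ i) : z j ∈ spanOthers i z :=
  Submodule.subset_span ⟨j, hj, rfl⟩

/-- An infimum of continuous functions is upper semicontinuous. Defining the distance as an infimum
avoids the measurability of a projection onto a varying subspace. -/
lemma measurable_distOthers [FiniteDimensional ℝ H] [MeasurableSpace H] [BorelSpace H] (i : Fin k) :
    Measurable (distOthers i : (Fin k → H) → ℝ) := by
  apply UpperSemicontinuous.measurable
  apply upperSemicontinuous_ciInf
  · exact fun z => ⟨0, by rintro _ ⟨c, rfl⟩; exact norm_nonneg _⟩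
  · intro c
    apply Continuous.upperSemicontinuous
    fun_prop

lemma distOthers_eq [FiniteDimensional ℝ H] (i : Fin k) (z : Fin k → H) :
    distOthers i z = ‖(spanOthers i z)ᗮ.orthogonalProjectionOnto (z i)‖ := by
  set W := spanOthers i z
  have hsum : ∀ c : Fin k → ℝ, ∑ j ∈ Finset.univ.erase i, c j • z j ∈ W := fun c =>
    Submodule.sum_mem _ fun j hj => Submodule.smul_mem _ _
      (mem_spanOthers z (Finset.ne_of_mem_erase hj))
  apply le_antisymm
  · have hP : (W.orthogonalProjectionOnto (z i) : H) ∈ Submodule.span ℝ (z '' (Finset.univ.erase i : Finset (Fin k))) := by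
      have h := (W.orthogonalProjectionOnto (z i)).2
      have he : ((Finset.univ.erase i : Finset (Fin k)) : Set (Fin k)) = {i}ᶜ := by ext; simp
      rw [he]
      exact h
    rw [Submodule.mem_span_image_finset_iff_exists_fun'] at hP
    obtain ⟨c, hc⟩ := hP
    have hbdd : BddBelow (Set.range fun c : Fin k → ℝ =>
        ‖z i - ∑ j ∈ Finset.univ.erase i, c j • z j‖) :=
      ⟨0, by rintro _ ⟨c, rfl⟩; positivity⟩
    refine (ciInf_le hbdd c).trans ?_
    have hQ : z i - W.orthogonalProjectionOnto (z i) = Wᗮ.orthogonalProjectionOnto (z i) := by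
      rw [sub_eq_iff_eq_add, add_comm]
      exact (Submodule.starProjection_add_starProjection_orthogonal (K := W) (z i)).symm
    rw [hc, hQ, Submodule.coe_norm]
  · refine le_ciInf fun c => ?_
    have h1 : Wᗮ.orthogonalProjectionOnto (z i) =
        Wᗮ.orthogonalProjectionOnto (z i - ∑ j ∈ Finset.univ.erase i, c j • z j) := by
      rw [map_sub, Submodule.orthogonalProjectionOnto_orthogonal_apply_eq_zero (hsum c), sub_zero]
    rw [h1]
    exact Wᗮ.norm_orthogonalProjectionOnto_apply_le _

end DistOthers

/-! ### Resampling one coordinate of a product measure -/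

section Resample

variable {k : ℕ} {α : Type*} [MeasurableSpace α]

/-- Replaces conditioning on the other coordinates: with z fixed, only the fresh i-th coordinate is
integrated. -/
lemma measurePreserving_update (μ : Measure α) [IsProbabilityMeasure μ] (i : Fin k) :
    MeasurePreserving (fun p : (Fin k → α) × α => Function.update p.1 i p.2)
      ((Measure.pi fun _ => μ).prod μ) (Measure.pi fun _ => μ) := by
  have hm : Measurable (fun p : (Fin k → α) × α => Function.update p.1 i p.2) := by
    rw [measurable_pi_iff]
    intro j
    by_cases hj : j = i
    · subst hj; simpa using measurable_snd
    · simp only [Function.update_of_ne hj]; fun_prop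
  refine ⟨hm, (Measure.pi_eq fun s hs => ?_).symm⟩
  rw [Measure.map_apply hm (MeasurableSet.univ_pi hs)]
  have hpre : (fun p : (Fin k → α) × α => Function.update p.1 i p.2) ⁻¹' (Set.univ.pi s) =
      (Set.univ.pi (Function.update s i Set.univ)) ×ˢ s i := by
    ext ⟨z, w⟩
    simp only [Set.mem_preimage, Set.mem_univ_pi, Set.mem_prod]
    constructor
    · intro h
      refine ⟨fun j => ?_, by simpa using h i⟩
      by_cases hj : j = i
      · subst hj; simp
      · simpa [hj] using h j
    · rintro ⟨h1, h2⟩ j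
      by_cases hj : j = i
      · subst hj; simpa using h2
      · simpa [hj] using h1 j
  rw [hpre, Measure.prod_prod, Measure.pi_pi]
  rw [← Finset.mul_prod_erase Finset.univ (fun j => μ (s j)) (Finset.mem_univ i),
    ← Finset.mul_prod_erase Finset.univ (fun j => μ (Function.update s i Set.univ j))
      (Finset.mem_univ i)]
  simp only [Function.update_self, measure_univ, one_mul]
  rw [mul_comm]
  congr 1
  refine Finset.prod_congr rfl fun j hj => ?_
  rw [Function.update_of_ne (Finset.ne_of_mem_erase hj)]

end Resample

/-! ### The score on the space of Gaussian families -/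

section PiGaussian

variable {k d : ℕ}

/-- The law of `k` independent standard Gaussian vectors in dimension `d`. -/
noncomputable abbrev gaussianVectors (k d : ℕ) : Measure (Fin k → EuclideanSpace ℝ (Fin d)) :=
  Measure.pi fun _ => stdGaussian (EuclideanSpace ℝ (Fin d))

lemma measurePreserving_update_gaussianVectors (i : Fin k) :
    MeasurePreserving (fun p : (Fin k → EuclideanSpace ℝ (Fin d)) × EuclideanSpace ℝ (Fin d) =>
      Function.update p.1 i p.2)
      ((gaussianVectors k d).prod (stdGaussian (EuclideanSpace ℝ (Fin d)))) (gaussianVectors k d) :=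
  measurePreserving_update _ i

lemma distOthers_update_add (i : Fin k) (z : Fin k → EuclideanSpace ℝ (Fin d))
    (a : spanOthers i z) (b : (spanOthers i z)ᗮ) :
    distOthers i (Function.update z i ((a : EuclideanSpace ℝ (Fin d)) + b)) = ‖b‖ := by
  -- The subspace is a variable because it occurs in types; this lets the span for the updated
  -- family be replaced by that for z.
  have h : ∀ (W : Submodule ℝ (EuclideanSpace ℝ (Fin d))) (z' : Fin k → EuclideanSpace ℝ (Fin d)),
      spanOthers i z' = W → distOthers i z' = ‖Wᗮ.orthogonalProjectionOnto (z' i)‖ := by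
    rintro W z' rfl
    exact distOthers_eq i z'
  rw [h _ _ (spanOthers_update i z _), Function.update_self, map_add,
    Submodule.orthogonalProjectionOnto_orthogonal_apply_eq_zero a.2, zero_add,
    Submodule.orthogonalProjectionOnto_mem_subspace_eq_self]

/-- The score of the scaling of the `i`-th row of the normalized Gram matrix. -/
noncomputable def scoreAt (i : Fin k) (z : Fin k → EuclideanSpace ℝ (Fin d)) : ℝ :=
  rowScore (k - 1) (‖z i‖ ^ 2 - distOthers i z ^ 2) (distOthers i z ^ 2)

@[fun_prop]
lemma measurable_scoreAt (i : Fin k) :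
    Measurable (scoreAt i : (Fin k → EuclideanSpace ℝ (Fin d)) → ℝ) := by
  have := measurable_distOthers (H := EuclideanSpace ℝ (Fin d)) i
  unfold scoreAt
  fun_prop

lemma scoreAt_update_add (i : Fin k) (z : Fin k → EuclideanSpace ℝ (Fin d))
    (a : spanOthers i z) (b : (spanOthers i z)ᗮ) :
    scoreAt i (Function.update z i ((a : EuclideanSpace ℝ (Fin d)) + b)) =
      rowScore (k - 1) (‖a‖ ^ 2) (‖b‖ ^ 2) := by
  rw [scoreAt, distOthers_update_add, Function.update_self, sq_norm_coe_add_coe]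
  simp

lemma finrank_spanOthers_le (i : Fin k) (z : Fin k → EuclideanSpace ℝ (Fin d)) :
    Module.finrank ℝ (spanOthers i z) ≤ k - 1 := by
  classical
  have he : ({i}ᶜ : Set (Fin k)) = ((Finset.univ.erase i : Finset (Fin k)) : Set (Fin k)) := by
    ext; simp
  have h := finrank_span_finset_le_card (R := ℝ) ((Finset.univ.erase i).image z)
  rw [Finset.coe_image, ← he] at h
  refine h.trans (Finset.card_image_le.trans ?_)
  simp

/-- A resampled i-th vector almost surely avoids the span of the others, which has dimension at most
k - 1 < d. -/
lemma ae_linearIndependent_gaussianVectors (hkd : k ≤ d) :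
    ∀ᵐ z ∂(gaussianVectors k d), LinearIndependent ℝ z := by
  have h : ∀ i : Fin k, ∀ᵐ z ∂(gaussianVectors k d), z i ∉ spanOthers i z := by
    intro i
    have hset : MeasurableSet {z : Fin k → EuclideanSpace ℝ (Fin d) | z i ∈ spanOthers i z} := by
      have : {z : Fin k → EuclideanSpace ℝ (Fin d) | z i ∈ spanOthers i z} =
          distOthers i ⁻¹' {0} := by
        ext z
        rw [Set.mem_preimage, Set.mem_singleton_iff, distOthers_eq, norm_eq_zero,
          Submodule.orthogonalProjectionOnto_eq_zero_iff, Submodule.orthogonal_orthogonal]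
        rfl
      rw [this]
      exact measurable_distOthers i (measurableSet_singleton 0)
    rw [ae_iff]
    simp only [not_not]
    have hmp := measurePreserving_update_gaussianVectors (d := d) i
    rw [← hmp.measure_preimage hset.nullMeasurableSet,
      Measure.measure_prod_null (hmp.measurable hset)]
    refine ae_of_all _ fun z => ?_
    have hpre : Prod.mk z ⁻¹' ((fun p : (Fin k → EuclideanSpace ℝ (Fin d)) ×
        EuclideanSpace ℝ (Fin d) => Function.update p.1 i p.2) ⁻¹'
        {z | z i ∈ spanOthers i z}) = (spanOthers i z : Set (EuclideanSpace ℝ (Fin d))) := by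
      ext w
      simp [spanOthers_update]
    beta_reduce
    rw [hpre]
    apply stdGaussian_submodule
    intro htop
    have h1 := finrank_spanOthers_le i z
    rw [htop, finrank_top, finrank_euclideanSpace_fin] at h1
    have := i.pos
    omega
  filter_upwards [ae_all_iff.2 h] with z hz
  rw [linearIndependent_iff_notMem_span]
  intro i
  have := hz i
  rwa [spanOthers, Set.compl_eq_univ_sdiff] at this

lemma finrank_spanOthers {z : Fin k → EuclideanSpace ℝ (Fin d)} (hz : LinearIndependent ℝ z)
    (i : Fin k) : Module.finrank ℝ (spanOthers i z) = k - 1 := by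
  have h := finrank_span_eq_card (hz.comp (Subtype.val : ({i}ᶜ : Set (Fin k)) → Fin k)
    Subtype.val_injective)
  rw [Set.range_comp, Subtype.range_val] at h
  rw [spanOthers, h, Fintype.card_compl_set]
  simp

lemma finrank_spanOthers_orthogonal {z : Fin k → EuclideanSpace ℝ (Fin d)}
    (hz : LinearIndependent ℝ z) (i : Fin k) :
    Module.finrank ℝ (spanOthers i z)ᗮ = d - (k - 1) := by
  have h := Submodule.finrank_add_finrank_orthogonal (spanOthers i z)
  rw [finrank_spanOthers hz, finrank_euclideanSpace_fin] at h
  omega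

/-- Integration by parts: `scoreAt i` is the score of the scaling of the `i`-th row. -/
lemma integral_rowPart_eq (hk : 2 ≤ k) (hkd : k + 4 ≤ d) (i : Fin k)
    {φ : (UpperPairs k → ℝ) → ℝ} (hφ : ContDiff ℝ 1 φ) {C : ℝ} (hφb : ∀ x, |φ x| ≤ C)
    (hφb' : ∀ x, |fderiv ℝ φ x (rowPart i x)| ≤ C)
    (hint : Integrable (scoreAt i) (gaussianVectors k d)) :
    ∫ z, fderiv ℝ φ (sphericalGram z) (rowPart i (sphericalGram z)) ∂(gaussianVectors k d) =
    ∫ z, φ (sphericalGram z) * scoreAt i z ∂(gaussianVectors k d) := by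
  have hmp := measurePreserving_update_gaussianVectors (d := d) i
  have hφc : Continuous φ := hφ.continuous
  have hφ'c : Continuous (fun x => fderiv ℝ φ x (rowPart i x)) :=
    (hφ.continuous_fderiv (by norm_num)).clm_apply (continuous_rowPart i)
  have hX := measurable_sphericalGram (k := k) (d := d)
  have m1 : Measurable (fun z : Fin k → EuclideanSpace ℝ (Fin d) =>
      fderiv ℝ φ (sphericalGram z) (rowPart i (sphericalGram z))) := hφ'c.measurable.comp hX
  have m0 : Measurable (fun z : Fin k → EuclideanSpace ℝ (Fin d) => φ (sphericalGram z)) :=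
    hφc.measurable.comp hX
  have m2 : Measurable (fun z : Fin k → EuclideanSpace ℝ (Fin d) =>
      φ (sphericalGram z) * scoreAt i z) := m0.mul (measurable_scoreAt i)
  have I1 : Integrable (fun z => fderiv ℝ φ (sphericalGram z) (rowPart i (sphericalGram z)))
      (gaussianVectors k d) :=
    Integrable.of_bound m1.aestronglyMeasurable C (ae_of_all _ fun z => hφb' _)
  have I2 : Integrable (fun z => φ (sphericalGram z) * scoreAt i z) (gaussianVectors k d) :=
    hint.bdd_mul m0.aestronglyMeasurable (ae_of_all _ fun z => hφb _)
  rw [← hmp.map_eq, integral_map hmp.aemeasurable m1.aestronglyMeasurable,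
    integral_map hmp.aemeasurable m2.aestronglyMeasurable,
    integral_prod _ (by exact hmp.integrable_comp_of_integrable I1),
    integral_prod _ (by exact hmp.integrable_comp_of_integrable I2)]
  refine integral_congr_ae ?_
  filter_upwards [ae_linearIndependent_gaussianVectors (by omega : k ≤ d)] with z hz
  -- The fresh i-th vector is split along the span of the others, where the score is `rowScore` of
  -- the two squared norms.
  have hsplit := measurePreserving_add_orthogonal (spanOthers i z)
  have mu : Measurable (Function.update z i) := measurable_update z
  have key := rowScore_identity_split z i (spanOthers i z) (fun j hj => mem_spanOthers z hj)
    (finrank_spanOthers hz i) (by omega) (by rw [finrank_spanOthers_orthogonal hz]; omega)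
    hφ hφb hφb'
  rw [← hsplit.map_eq, integral_map hsplit.aemeasurable (by exact (m1.comp mu).aestronglyMeasurable),
    integral_map hsplit.aemeasurable (by exact (m2.comp mu).aestronglyMeasurable), key]
  refine integral_congr_ae (ae_of_all _ fun p => ?_)
  beta_reduce
  rw [scoreAt_update_add]

/-- Resampling and splitting reduce this to `rowScore_second_moment` with m = k - 1 and n = d - (k -
1). Lower integrals give the bound and the integrability at once. -/
lemma scoreAt_second_moment (hk : 2 ≤ k) (hkd : 2 * k + 20 ≤ d) (i : Fin k) :
    Integrable (fun z => scoreAt i z ^ 2) (gaussianVectors k d) ∧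
    ∫ z, scoreAt i z ^ 2 ∂(gaussianVectors k d) ≤ 8 * k := by
  have hmp := measurePreserving_update_gaussianVectors (d := d) i
  have ms : Measurable (fun z : Fin k → EuclideanSpace ℝ (Fin d) => ENNReal.ofReal (scoreAt i z ^ 2)) := by
    fun_prop
  have hle : ∫⁻ z, ENNReal.ofReal (scoreAt i z ^ 2) ∂(gaussianVectors k d) ≤
      ENNReal.ofReal (8 * k) := by
    rw [← hmp.lintegral_comp ms, lintegral_prod _ (by exact (ms.comp hmp.measurable).aemeasurable)]
    have hin : ∀ᵐ z ∂(gaussianVectors k d),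
        ∫⁻ w, ENNReal.ofReal (scoreAt i (Function.update z i w) ^ 2)
          ∂(stdGaussian (EuclideanSpace ℝ (Fin d))) ≤ ENNReal.ofReal (8 * k) := by
      filter_upwards [ae_linearIndependent_gaussianVectors (by omega : k ≤ d)] with z hz
      have hsplit := measurePreserving_add_orthogonal (spanOthers i z)
      have mu : Measurable (Function.update z i) := measurable_update z
      have hfr := finrank_spanOthers hz i
      have : Nontrivial (spanOthers i z) :=
        Module.nontrivial_of_finrank_pos (R := ℝ) (by omega)
      have hmom := rowScore_second_moment (E := spanOthers i z) (F := (spanOthers i z)ᗮ) hfr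
        (finrank_spanOthers_orthogonal hz i) (by omega)
      rw [← hsplit.lintegral_comp
        (f := fun w => ENNReal.ofReal (scoreAt i (Function.update z i w) ^ 2)) (ms.comp mu)]
      simp only [scoreAt_update_add]
      rw [← ofReal_integral_eq_lintegral_ofReal hmom.1 (ae_of_all _ fun p => sq_nonneg _)]
      apply ENNReal.ofReal_le_ofReal
      refine hmom.2.trans ?_
      have hm1 : ((k - 1 : ℕ) : ℝ) = k - 1 := by push_cast [show 1 ≤ k by omega]; ring
      have hn1 : ((d - (k - 1) : ℕ) : ℝ) = d - (k - 1) := by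
        rw [Nat.cast_sub (by omega), hm1]
      rw [hm1, hn1]
      have hk' : (2 : ℝ) ≤ k := by exact_mod_cast hk
      have hd' : (2 * k + 20 : ℝ) ≤ d := by exact_mod_cast hkd
      -- As d ≥ 2k + 20, m + 2 ≤ n - 2 and m + 6 ≤ n - 4, so the second term is at most the first.
      have hq : 4 * (((k : ℝ) - 1) * (k - 1 + 2) * (k - 1 + 6)) /
          ((d - (k - 1) - 2) * (d - (k - 1) - 4)) ≤ 4 * (k - 1) := by
        rw [div_le_iff₀ (by apply mul_pos <;> linarith)]
        have : ((k : ℝ) - 1 + 2) * (k - 1 + 6) ≤ (d - (k - 1) - 2) * (d - (k - 1) - 4) := by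
          apply mul_le_mul <;> linarith
        calc 4 * (((k : ℝ) - 1) * (k - 1 + 2) * (k - 1 + 6))
            = 4 * (k - 1) * ((k - 1 + 2) * (k - 1 + 6)) := by ring
          _ ≤ _ := by gcongr; linarith
      linarith
    calc _ ≤ ∫⁻ _, ENNReal.ofReal (8 * k) ∂(gaussianVectors k d) := lintegral_mono_ae hin
      _ = ENNReal.ofReal (8 * k) := by simp
  have hI : Integrable (fun z => scoreAt i z ^ 2) (gaussianVectors k d) := by
    refine ⟨Measurable.aestronglyMeasurable (by fun_prop), ?_⟩
    rw [hasFiniteIntegral_iff_ofReal (ae_of_all _ fun z => sq_nonneg _)]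
    exact hle.trans_lt ENNReal.ofReal_lt_top
  refine ⟨hI, ?_⟩
  rw [← ofReal_integral_eq_lintegral_ofReal hI (ae_of_all _ fun z => sq_nonneg _)] at hle
  exact (ENNReal.ofReal_le_ofReal_iff (by positivity)).1 hle

lemma memLp_scoreAt (hk : 2 ≤ k) (hkd : 2 * k + 20 ≤ d) (i : Fin k) :
    MemLp (scoreAt i) 2 (gaussianVectors k d) :=
  (memLp_two_iff_integrable_sq (measurable_scoreAt i).aestronglyMeasurable).2
    (scoreAt_second_moment hk hkd i).1

end PiGaussian

/-! ### Interpolation along row scalings -/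

section Path

variable {k d : ℕ}

/-- Multiplication of the entry at `(i, j)` by `exp (l i + l j)`. -/
noncomputable def scaleEntries (l : Fin k → ℝ) : (UpperPairs k → ℝ) →L[ℝ] (UpperPairs k → ℝ) :=
  ContinuousLinearMap.pi fun e =>
    Real.exp (l e.1.1 + l e.1.2) • ContinuousLinearMap.proj (R := ℝ) e

lemma scaleEntries_apply (l : Fin k → ℝ) (x : UpperPairs k → ℝ) (e : UpperPairs k) :
    scaleEntries l x e = Real.exp (l e.1.1 + l e.1.2) * x e := rfl

/-- Both maps are diagonal. This commutation carries the integration by parts from the unscaled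
matrix to every point of the path. -/
lemma rowPart_scaleEntries (i : Fin k) (l : Fin k → ℝ) (x : UpperPairs k → ℝ) :
    rowPart i (scaleEntries l x) = scaleEntries l (rowPart i x) := by
  ext e
  simp only [rowPart, scaleEntries_apply]
  ring

lemma sum_mul_incidence (l : Fin k → ℝ) (e : UpperPairs k) :
    ∑ i, l i * incidence i e = l e.1.1 + l e.1.2 := by
  simp [incidence, mul_add, Finset.sum_add_distrib]

lemma hasDerivAt_scaleEntries_smul (l : Fin k → ℝ) (x : UpperPairs k → ℝ) (t : ℝ) :
    HasDerivAt (fun t : ℝ => scaleEntries (t • l) x)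
      (∑ i, l i • rowPart i (scaleEntries (t • l) x)) t := by
  rw [hasDerivAt_pi]
  intro e
  simp only [scaleEntries_apply, Finset.sum_apply, Pi.smul_apply, smul_eq_mul, rowPart]
  have h : HasDerivAt (fun t : ℝ => t * l e.1.1 + t * l e.1.2) (l e.1.1 + l e.1.2) t := by
    exact (((hasDerivAt_id t).mul_const (l e.1.1)).add
      ((hasDerivAt_id t).mul_const (l e.1.2))).congr_deriv (by simp)
  refine (h.exp.mul_const (x e)).congr_deriv ?_
  rw [← sum_mul_incidence l e, Finset.mul_sum, Finset.sum_mul]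
  refine Finset.sum_congr rfl fun i _ => ?_
  ring

lemma exists_bound_fderiv_rowPart {φ : (UpperPairs k → ℝ) → ℝ} (hφ : ContDiff ℝ 1 φ)
    (hφc : HasCompactSupport φ) : ∃ C : ℝ, ∀ i x, |fderiv ℝ φ x (rowPart i x)| ≤ C := by
  have h : ∀ i, ∃ C : ℝ, ∀ x, |fderiv ℝ φ x (rowPart i x)| ≤ C := by
    intro i
    have hc : HasCompactSupport (fun x => fderiv ℝ φ x (rowPart i x)) := by
      refine (hφc.fderiv (𝕜 := ℝ)).mono fun x hx => ?_
      rw [Function.mem_support] at hx ⊢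
      intro h0
      simp [h0] at hx
    obtain ⟨C, hC⟩ := hc.exists_bound_of_continuous
      ((hφ.continuous_fderiv (by norm_num)).clm_apply (continuous_rowPart i))
    exact ⟨C, hC⟩
  choose C hC using h
  refine ⟨∑ i, |C i|, fun i x => (hC i x).trans ((le_abs_self _).trans ?_)⟩
  exact Finset.single_le_sum (f := fun i => |C i|) (fun _ _ => abs_nonneg _) (Finset.mem_univ i)

/-- The effect on expectations of scaling the normalized Gram matrix is controlled by the scores. -/
lemma abs_integral_scaleEntries_sub_le (hk : 2 ≤ k) (hkd : 2 * k + 20 ≤ d)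
    {φ : (UpperPairs k → ℝ) → ℝ} (hφ : ContDiff ℝ 1 φ) (hφc : HasCompactSupport φ)
    (hφ1 : ∀ x, 0 ≤ φ x ∧ φ x ≤ 1) (l : Fin k → ℝ) :
    |∫ z, φ (scaleEntries l (sphericalGram z)) ∂(gaussianVectors k d) -
      ∫ z, φ (sphericalGram z) ∂(gaussianVectors k d)| ≤
    ∫ z, |∑ i, l i * scoreAt i z| ∂(gaussianVectors k d) := by
  obtain ⟨C', hC'⟩ := exists_bound_fderiv_rowPart hφ hφc
  set C := max C' 1 with hCdef
  have hC : ∀ i x, |fderiv ℝ φ x (rowPart i x)| ≤ C := fun i x => (hC' i x).trans (le_max_left _ _)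
  have hφb : ∀ x, |φ x| ≤ 1 := fun x => by rw [abs_of_nonneg (hφ1 x).1]; exact (hφ1 x).2
  have hscore : ∀ i, Integrable (scoreAt i) (gaussianVectors k d) := fun i =>
    (memLp_scoreAt hk hkd i).integrable (by norm_num)
  have hX := measurable_sphericalGram (k := k) (d := d)
  have hφm : Continuous φ := hφ.continuous
  have hφ' : ∀ i, Continuous (fun x => fderiv ℝ φ x (rowPart i x)) := fun i =>
    (hφ.continuous_fderiv (by norm_num)).clm_apply (continuous_rowPart i)
  have hmeas : ∀ s : Fin k → ℝ, Measurable (fun z : Fin k → EuclideanSpace ℝ (Fin d) =>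
      φ (scaleEntries s (sphericalGram z))) := fun s =>
    (hφm.comp (scaleEntries s).continuous).measurable.comp hX
  have hmeas' : ∀ i, ∀ s : Fin k → ℝ, Measurable (fun z : Fin k → EuclideanSpace ℝ (Fin d) =>
      fderiv ℝ φ (scaleEntries s (sphericalGram z)) (rowPart i (scaleEntries s (sphericalGram z)))) :=
    fun i s => ((hφ' i).comp (scaleEntries s).continuous).measurable.comp hX
  have hint' : ∀ i, ∀ s : Fin k → ℝ, Integrable (fun z : Fin k → EuclideanSpace ℝ (Fin d) =>
      fderiv ℝ φ (scaleEntries s (sphericalGram z)) (rowPart i (scaleEntries s (sphericalGram z))))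
      (gaussianVectors k d) := fun i s =>
    Integrable.of_bound (hmeas' i s).aestronglyMeasurable C (ae_of_all _ fun z => hC _ _)
  -- The identity is applied to φ ∘ `scaleEntries s`, so the score is the same for all s.
  have hrow : ∀ i, ∀ s : Fin k → ℝ, ∫ z, fderiv ℝ φ (scaleEntries s (sphericalGram z))
      (rowPart i (scaleEntries s (sphericalGram z))) ∂(gaussianVectors k d) =
      ∫ z, φ (scaleEntries s (sphericalGram z)) * scoreAt i z ∂(gaussianVectors k d) := by
    intro i s
    have hfd : ∀ x, fderiv ℝ (fun x => φ (scaleEntries s x)) x (rowPart i x) =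
        fderiv ℝ φ (scaleEntries s x) (rowPart i (scaleEntries s x)) := by
      intro x
      have h1 : HasFDerivAt φ (fderiv ℝ φ (scaleEntries s x)) (scaleEntries s x) :=
        (hφ.differentiable (by norm_num)).differentiableAt.hasFDerivAt
      have h2 := h1.comp x (scaleEntries s).hasFDerivAt
      have h3 : fderiv ℝ (fun x => φ (scaleEntries s x)) x =
        (fderiv ℝ φ (scaleEntries s x)).comp (scaleEntries s) := h2.fderiv
      rw [h3, rowPart_scaleEntries]
      rfl
    have := integral_rowPart_eq (d := d) hk (by omega) i (φ := fun x => φ (scaleEntries s x))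
      (hφ.comp (scaleEntries s).contDiff) (C := C)
      (fun x => (hφb _).trans (le_max_right _ _)) (fun x => by rw [hfd]; exact hC _ _) (hscore i)
    simp_rw [hfd] at this
    exact this
  set g : ℝ → ℝ := fun t => ∫ z, φ (scaleEntries (t • l) (sphericalGram z)) ∂(gaussianVectors k d)
  set g' : ℝ → ℝ := fun t => ∫ z, φ (scaleEntries (t • l) (sphericalGram z)) *
    ∑ i, l i * scoreAt i z ∂(gaussianVectors k d)
  have hg : ∀ t, HasDerivAt g (g' t) t := by
    intro t
    have hd := (hasDerivAt_integral_of_dominated_loc_of_deriv_le (μ := gaussianVectors k d)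
      (s := Set.univ) (x₀ := t) (bound := fun _ => ∑ i, |l i| * C)
      (F := fun t z => φ (scaleEntries (t • l) (sphericalGram z)))
      (F' := fun t z => ∑ i, l i * fderiv ℝ φ (scaleEntries (t • l) (sphericalGram z))
        (rowPart i (scaleEntries (t • l) (sphericalGram z)))) univ_mem
      (Eventually.of_forall fun t => (hmeas _).aestronglyMeasurable)
      (Integrable.of_bound (hmeas _).aestronglyMeasurable 1 (ae_of_all _ fun z => hφb _))
      (Measurable.aestronglyMeasurable
        (Finset.measurable_fun_sum _ fun i _ => (hmeas' i _).const_mul _)) ?_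
      (integrable_const _) ?_).2
    · refine hd.congr_deriv ?_
      rw [integral_finsetSum _ fun i _ => (hint' i _).const_mul _]
      simp only [g', Finset.mul_sum]
      rw [integral_finsetSum]
      · refine Finset.sum_congr rfl fun i _ => ?_
        rw [integral_const_mul, hrow, ← integral_const_mul]
        congr 1 with z
        ring
      · intro i _
        exact ((hscore i).const_mul (l i)).bdd_mul (hmeas _).aestronglyMeasurable
          (ae_of_all _ fun z => hφb _)
    · refine ae_of_all _ fun z s _ => ?_
      refine (norm_sum_le _ _).trans (Finset.sum_le_sum fun i _ => ?_)
      rw [norm_mul]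
      exact mul_le_mul_of_nonneg_left (hC _ _) (abs_nonneg _)
    · refine ae_of_all _ fun z s _ => ?_
      have h1 : HasFDerivAt φ (fderiv ℝ φ (scaleEntries (s • l) (sphericalGram z)))
          (scaleEntries (s • l) (sphericalGram z)) :=
        (hφ.differentiable (by norm_num)).differentiableAt.hasFDerivAt
      refine (h1.comp_hasDerivAt s (hasDerivAt_scaleEntries_smul l (sphericalGram z) s)).congr_deriv ?_
      simp [map_sum]
  have hsum : Integrable (fun z => ∑ i, l i * scoreAt i z) (gaussianVectors k d) :=
    integrable_finsetSum _ fun i _ => (hscore i).const_mul (l i)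
  -- Mean value inequality on [0, 1]: |φ| ≤ 1 bounds the derivative uniformly in t and φ.
  have hfinal := norm_image_sub_le_of_norm_deriv_le_segment_01' (f := g) (f' := g')
    (C := ∫ z, |∑ i, l i * scoreAt i z| ∂(gaussianVectors k d))
    (fun t _ => (hg t).hasDerivWithinAt) (fun t _ => ?_)
  · have h0 : g 0 = ∫ z, φ (sphericalGram z) ∂(gaussianVectors k d) := by
      simp only [g]
      congr 1 with z
      congr 1
      ext e
      simp [scaleEntries_apply]
    have h1 : g 1 = ∫ z, φ (scaleEntries l (sphericalGram z)) ∂(gaussianVectors k d) := by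
      simp [g]
    rwa [h0, h1] at hfinal
  · refine (norm_integral_le_integral_norm _).trans ?_
    refine integral_mono_of_nonneg (ae_of_all _ fun z => norm_nonneg _) hsum.abs
      (ae_of_all _ fun z => ?_)
    simp only [norm_mul, Real.norm_eq_abs]
    exact mul_le_of_le_one_left (abs_nonneg _) (hφb _)

end Path

/-! ### Fluctuations of the logarithm of the norm -/

section LogNorm

variable {d : ℕ}

/-- The logarithm of the norm of a vector, relative to its typical size `√d`. -/
noncomputable def logRelNorm (x : EuclideanSpace ℝ (Fin d)) : ℝ := Real.log (‖x‖ / Real.sqrt d)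

@[fun_prop]
lemma measurable_logRelNorm : Measurable (logRelNorm : EuclideanSpace ℝ (Fin d) → ℝ) := by
  unfold logRelNorm; fun_prop

/-- This is |x| ≤ |sinh x| at x = log v / 2, since 4 sinh² x = v - 2 + v⁻¹. -/
lemma sq_log_le {v : ℝ} (hv : 0 < v) : Real.log v ^ 2 ≤ v - 2 + v⁻¹ := by
  set x := Real.log v / 2 with hx
  have h1 : |x| ≤ |Real.sinh x| := by
    rw [Real.abs_sinh]
    exact Real.self_le_sinh_iff.2 (abs_nonneg _)
  have h2 : x ^ 2 ≤ Real.sinh x ^ 2 := sq_le_sq.2 h1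
  have h3 : Real.sinh x ^ 2 = (v - 2 + v⁻¹) / 4 := by
    have e1 : Real.exp x * Real.exp x = v := by
      rw [← Real.exp_add, hx, add_halves, Real.exp_log hv]
    have e2 : Real.exp (-x) * Real.exp (-x) = v⁻¹ := by
      rw [← Real.exp_add, hx, ← neg_add, add_halves, Real.exp_neg, Real.exp_log hv]
    have e3 : Real.exp x * Real.exp (-x) = 1 := by rw [← Real.exp_add]; simp
    rw [Real.sinh_eq]
    nlinarith
  rw [h3, hx] at h2
  nlinarith

/-- With v = ‖x‖² / d, E v = 1 and E v⁻¹ = d / (d - 2). `sq_log_le` bounds the second moment, and 1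
- v⁻¹ ≤ log v ≤ v - 1 puts the mean between -1 / (d - 2) and 0. -/
lemma logRelNorm_bounds (hd : 2 < d) :
    Integrable (fun x : EuclideanSpace ℝ (Fin d) => logRelNorm x ^ 2)
      (stdGaussian (EuclideanSpace ℝ (Fin d))) ∧
    ∫ x : EuclideanSpace ℝ (Fin d), logRelNorm x ^ 2 ∂(stdGaussian (EuclideanSpace ℝ (Fin d))) ≤
      1 / (2 * (d - 2)) ∧
    (∫ x : EuclideanSpace ℝ (Fin d), logRelNorm x ∂(stdGaussian (EuclideanSpace ℝ (Fin d)))) ^ 2 ≤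
      (1 / (d - 2)) ^ 2 := by
  set γ := stdGaussian (EuclideanSpace ℝ (Fin d)) with hγ
  have hfr : Module.finrank ℝ (EuclideanSpace ℝ (Fin d)) = d := finrank_euclideanSpace_fin
  have hnt : Nontrivial (EuclideanSpace ℝ (Fin d)) :=
    Module.nontrivial_of_finrank_pos (R := ℝ) (by omega)
  have hd' : (2 : ℝ) < d := by exact_mod_cast hd
  have hd0 : (0 : ℝ) < d := by linarith
  have hne : ∀ᵐ x : EuclideanSpace ℝ (Fin d) ∂γ, x ≠ 0 := by
    have h := stdGaussian_submodule (E := EuclideanSpace ℝ (Fin d)) (W := ⊥) bot_ne_top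
    simpa [ae_iff] using h
  have P2 : Integrable (fun x : EuclideanSpace ℝ (Fin d) => ‖x‖ ^ 2 / d) γ :=
    (integrable_norm_pow_stdGaussian _ 2).div_const _
  have N2 : Integrable (fun x : EuclideanSpace ℝ (Fin d) => d * (‖x‖ ^ 2)⁻¹) γ :=
    (integrable_inv_norm_pow_stdGaussian (by omega)).const_mul _
  have E2 : ∫ x : EuclideanSpace ℝ (Fin d), ‖x‖ ^ 2 / d ∂γ = 1 := by
    rw [integral_div, integral_norm_sq_stdGaussian, hfr, div_self hd0.ne']
  have F2 : ∫ x : EuclideanSpace ℝ (Fin d), d * (‖x‖ ^ 2)⁻¹ ∂γ = d / (d - 2) := by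
    rw [integral_const_mul, integral_inv_norm_sq_stdGaussian (by omega), hfr, mul_one_div]
  have hlog : ∀ x : EuclideanSpace ℝ (Fin d), x ≠ 0 →
      0 < ‖x‖ ^ 2 / d ∧ logRelNorm x = Real.log (‖x‖ ^ 2 / d) / 2 ∧
        (‖x‖ ^ 2 / d)⁻¹ = d * (‖x‖ ^ 2)⁻¹ := by
    intro x hx
    have hx' : 0 < ‖x‖ := norm_pos_iff.2 hx
    refine ⟨by positivity, ?_, by rw [inv_div, div_eq_mul_inv]⟩
    have : ‖x‖ ^ 2 / d = (‖x‖ / Real.sqrt d) ^ 2 := by rw [div_pow, Real.sq_sqrt hd0.le]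
    rw [this, Real.log_pow, logRelNorm]
    push_cast
    ring
  have hb : Integrable (fun x : EuclideanSpace ℝ (Fin d) =>
      (‖x‖ ^ 2 / d - 2 + d * (‖x‖ ^ 2)⁻¹) / 4) γ :=
    ((P2.sub (integrable_const _)).add N2).div_const _
  have hsq : ∀ᵐ x : EuclideanSpace ℝ (Fin d) ∂γ,
      logRelNorm x ^ 2 ≤ (‖x‖ ^ 2 / d - 2 + d * (‖x‖ ^ 2)⁻¹) / 4 := by
    filter_upwards [hne] with x hx
    obtain ⟨h1, h2, h3⟩ := hlog x hx
    have := sq_log_le h1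
    rw [h2, ← h3]
    nlinarith
  have I2 : Integrable (fun x : EuclideanSpace ℝ (Fin d) => logRelNorm x ^ 2) γ := by
    refine hb.mono' (Measurable.aestronglyMeasurable (by fun_prop)) ?_
    filter_upwards [hsq] with x hx
    rwa [Real.norm_of_nonneg (sq_nonneg _)]
  have I1 : Integrable (fun x : EuclideanSpace ℝ (Fin d) => logRelNorm x) γ :=
    ((memLp_two_iff_integrable_sq measurable_logRelNorm.aestronglyMeasurable).2 I2).integrable
      (by norm_num)
  refine ⟨I2, ?_, ?_⟩
  · refine (integral_mono_ae I2 hb hsq).trans ?_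
    rw [integral_div, integral_add (by exact P2.sub (integrable_const _)) N2,
      integral_sub P2 (integrable_const _), E2, F2]
    simp only [integral_const, probReal_univ, one_smul]
    apply le_of_eq
    have : (d : ℝ) - 2 ≠ 0 := by linarith
    field_simp
    ring
  · rw [sq_le_sq, abs_of_pos (by apply one_div_pos.2; linarith : (0 : ℝ) < 1 / (d - 2)), abs_le]
    have hup : ∫ x : EuclideanSpace ℝ (Fin d), logRelNorm x ∂γ ≤
        ∫ x : EuclideanSpace ℝ (Fin d), (‖x‖ ^ 2 / d - 1) / 2 ∂γ := by
      refine integral_mono_ae I1 ((P2.sub (integrable_const _)).div_const _) ?_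
      filter_upwards [hne] with x hx
      obtain ⟨h1, h2, h3⟩ := hlog x hx
      rw [h2]
      have := Real.log_le_sub_one_of_pos h1
      linarith
    have hlo : ∫ x : EuclideanSpace ℝ (Fin d), (1 - d * (‖x‖ ^ 2)⁻¹) / 2 ∂γ ≤
        ∫ x : EuclideanSpace ℝ (Fin d), logRelNorm x ∂γ := by
      refine integral_mono_ae (((integrable_const _).sub N2).div_const _) I1 ?_
      filter_upwards [hne] with x hx
      obtain ⟨h1, h2, h3⟩ := hlog x hx
      rw [h2, ← h3]
      have := Real.one_sub_inv_le_log_of_pos h1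
      linarith
    rw [integral_div, integral_sub P2 (integrable_const _), E2] at hup
    rw [integral_div, integral_sub (integrable_const _) N2, F2] at hlo
    simp only [integral_const, probReal_univ, one_smul] at hup hlo
    have hpos : (0 : ℝ) < 1 / (d - 2) := one_div_pos.2 (by linarith)
    have h4 : (1 - d / (d - 2) : ℝ) / 2 = -(1 / (d - 2)) := by
      have : (d : ℝ) - 2 ≠ 0 := by linarith
      field_simp
      ring
    rw [h4] at hlo
    constructor <;> linarith

end LogNorm

/-! ### Averaging over the independent norms -/

section Averaging

variable {k d : ℕ}

lemma measurePreserving_withNormOf_pi (hd : 0 < d) :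
    MeasurePreserving (fun p : (Fin k → EuclideanSpace ℝ (Fin d)) ×
      (Fin k → EuclideanSpace ℝ (Fin d)) => fun i => withNormOf (p.1 i, p.2 i))
      ((gaussianVectors k d).prod (gaussianVectors k d)) (gaussianVectors k d) := by
  have hnt : Nontrivial (EuclideanSpace ℝ (Fin d)) :=
    Module.nontrivial_of_finrank_pos (R := ℝ) (by rw [finrank_euclideanSpace_fin]; exact hd)
  have h1 := (measurePreserving_arrowProdEquivProdArrow (EuclideanSpace ℝ (Fin d))
    (EuclideanSpace ℝ (Fin d)) (Fin k) (fun _ => stdGaussian (EuclideanSpace ℝ (Fin d)))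
    (fun _ => stdGaussian (EuclideanSpace ℝ (Fin d)))).symm
  have h2 := measurePreserving_pi
    (fun _ : Fin k => (stdGaussian (EuclideanSpace ℝ (Fin d))).prod
      (stdGaussian (EuclideanSpace ℝ (Fin d))))
    (fun _ : Fin k => stdGaussian (EuclideanSpace ℝ (Fin d)))
    (fun _ => measurePreserving_withNormOf)
  exact h2.comp h1

lemma scaledGram_withNormOf (hd : 0 < d) (ζ z : Fin k → EuclideanSpace ℝ (Fin d))
    (hζ : ∀ i, ζ i ≠ 0) :
    scaledGram (fun i => withNormOf (ζ i, z i)) =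
      scaleEntries (fun i => logRelNorm (ζ i)) (sphericalGram z) := by
  have hd' : (0 : ℝ) < d := by exact_mod_cast hd
  have hs : 0 < Real.sqrt d := Real.sqrt_pos.2 hd'
  ext e
  have h1 : 0 < ‖ζ e.1.1‖ := norm_pos_iff.2 (hζ _)
  have h2 : 0 < ‖ζ e.1.2‖ := norm_pos_iff.2 (hζ _)
  rw [scaleEntries_apply, Real.exp_add, logRelNorm, logRelNorm, Real.exp_log (by positivity),
    Real.exp_log (by positivity), div_mul_div_comm, Real.mul_self_sqrt hd'.le]
  simp only [scaledGram, sphericalGram, withNormOf, inner_smul_left, inner_smul_right,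
    div_eq_mul_inv, mul_inv, conj_trivial]
  ring

lemma ae_ne_zero_gaussianVectors (hd : 0 < d) :
    ∀ᵐ z ∂(gaussianVectors k d), ∀ i, z i ≠ 0 := by
  have hnt : Nontrivial (EuclideanSpace ℝ (Fin d)) :=
    Module.nontrivial_of_finrank_pos (R := ℝ) (by rw [finrank_euclideanSpace_fin]; exact hd)
  have h := stdGaussian_submodule (E := EuclideanSpace ℝ (Fin d)) (W := ⊥) bot_ne_top
  have hne : ∀ᵐ x ∂(stdGaussian (EuclideanSpace ℝ (Fin d))), x ≠ 0 := by
    simpa [ae_iff] using h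
  refine ae_all_iff.2 fun i => ?_
  exact (measurePreserving_eval (fun _ : Fin k =>
    stdGaussian (EuclideanSpace ℝ (Fin d))) i).quasiMeasurePreserving.ae hne

lemma integral_comp_eval_gaussianVectors (i : Fin k) {f : EuclideanSpace ℝ (Fin d) → ℝ}
    (hf : Measurable f) :
    ∫ ζ, f (ζ i) ∂(gaussianVectors k d) = ∫ x, f x ∂(stdGaussian (EuclideanSpace ℝ (Fin d))) := by
  have hmp := measurePreserving_eval (fun _ : Fin k => stdGaussian (EuclideanSpace ℝ (Fin d))) i
  conv_rhs => rw [← hmp.map_eq]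
  rw [integral_map hmp.aemeasurable hf.aestronglyMeasurable]

lemma memLp_logRelNorm_eval (hd : 2 < d) (i : Fin k) :
    MemLp (fun ζ => logRelNorm (ζ i)) 2 (gaussianVectors k d) :=
  ((memLp_two_iff_integrable_sq measurable_logRelNorm.aestronglyMeasurable).2
    (logRelNorm_bounds hd).1).comp_measurePreserving
    (measurePreserving_eval (fun _ : Fin k => stdGaussian (EuclideanSpace ℝ (Fin d))) i)

/-- Off the diagonal, independence gives the square of the mean. Nonnegativity allows multiplication
by the one-sided bound on the score products. -/
lemma integral_logRelNorm_mul_le (hd : 2 < d) (i j : Fin k) :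
    0 ≤ ∫ ζ, logRelNorm (ζ i) * logRelNorm (ζ j) ∂(gaussianVectors k d) ∧
    ∫ ζ, logRelNorm (ζ i) * logRelNorm (ζ j) ∂(gaussianVectors k d) ≤
      (if i = j then 1 / (2 * ((d : ℝ) - 2)) else 0) + (1 / ((d : ℝ) - 2)) ^ 2 := by
  obtain ⟨-, h2, h1⟩ := logRelNorm_bounds hd
  by_cases hij : i = j
  · subst hij
    simp only [← pow_two, if_true]
    rw [integral_comp_eval_gaussianVectors i (f := fun x => logRelNorm x ^ 2) (by fun_prop)]
    refine ⟨integral_nonneg fun x => sq_nonneg _, h2.trans ?_⟩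
    have := sq_nonneg (1 / ((d : ℝ) - 2))
    linarith
  · have hind := (iIndepFun_pi (μ := fun _ : Fin k => stdGaussian (EuclideanSpace ℝ (Fin d)))
      (X := fun _ => logRelNorm) (fun _ => measurable_logRelNorm.aemeasurable)).indepFun hij
    have hm := hind.integral_fun_mul_eq_mul_integral
      (Measurable.aestronglyMeasurable (by fun_prop)) (Measurable.aestronglyMeasurable (by fun_prop))
    rw [if_neg hij, zero_add]
    change ∫ ζ, logRelNorm (ζ i) * logRelNorm (ζ j) ∂(gaussianVectors k d) =
      (∫ ζ, logRelNorm (ζ i) ∂(gaussianVectors k d)) *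
      (∫ ζ, logRelNorm (ζ j) ∂(gaussianVectors k d)) at hm
    rw [hm, integral_comp_eval_gaussianVectors i measurable_logRelNorm,
      integral_comp_eval_gaussianVectors j measurable_logRelNorm, ← pow_two]
    exact ⟨sq_nonneg _, h1⟩

lemma sq_integral_abs_le {Ω : Type*} [MeasurableSpace Ω] {μ : Measure Ω} [IsProbabilityMeasure μ]
    {X : Ω → ℝ} (hX : MemLp X 2 μ) : (∫ ω, |X ω| ∂μ) ^ 2 ≤ ∫ ω, X ω ^ 2 ∂μ := by
  have h := variance_nonneg (fun ω => |X ω|) μ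
  rw [variance_eq_sub (by exact hX.abs)] at h
  simpa using h

/-- The square of the sum is expanded and each term factors by independence. The k diagonal terms
are O(k/d) each, the k² mean terms O(k/d²). -/
lemma integral_abs_sum_logRelNorm_mul_scoreAt_le (hk : 2 ≤ k) (hkd : 2 * k + 20 ≤ d) :
    ∫ p, |∑ i, logRelNorm (p.1 i) * scoreAt i p.2|
      ∂((gaussianVectors k d).prod (gaussianVectors k d)) ≤ Real.sqrt (16 * (k ^ 2 / d)) ∧
    Integrable (fun p : (Fin k → EuclideanSpace ℝ (Fin d)) × (Fin k → EuclideanSpace ℝ (Fin d)) =>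
      |∑ i, logRelNorm (p.1 i) * scoreAt i p.2|)
      ((gaussianVectors k d).prod (gaussianVectors k d)) := by
  set M := (gaussianVectors k d).prod (gaussianVectors k d)
  have hl : ∀ i j : Fin k, Integrable (fun ζ => logRelNorm (ζ i) * logRelNorm (ζ j))
      (gaussianVectors k d) := fun i j =>
    (memLp_logRelNorm_eval (by omega) i).integrable_mul (memLp_logRelNorm_eval (by omega) j)
  have hs : ∀ i j : Fin k, Integrable (fun z => scoreAt i z * scoreAt j z)
      (gaussianVectors k d) := fun i j =>
    (memLp_scoreAt hk hkd i).integrable_mul (memLp_scoreAt hk hkd j)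
  have hprod : ∀ i j : Fin k, Integrable (fun p : (Fin k → EuclideanSpace ℝ (Fin d)) ×
      (Fin k → EuclideanSpace ℝ (Fin d)) => (logRelNorm (p.1 i) * logRelNorm (p.1 j)) *
        (scoreAt i p.2 * scoreAt j p.2)) M := fun i j => (hl i j).mul_prod (hs i j)
  have hexpand : ∀ p : (Fin k → EuclideanSpace ℝ (Fin d)) × (Fin k → EuclideanSpace ℝ (Fin d)),
      (∑ i, logRelNorm (p.1 i) * scoreAt i p.2) ^ 2 =
      ∑ i, ∑ j, (logRelNorm (p.1 i) * logRelNorm (p.1 j)) * (scoreAt i p.2 * scoreAt j p.2) := by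
    intro p
    rw [pow_two, Finset.sum_mul_sum]
    refine Finset.sum_congr rfl fun i _ => Finset.sum_congr rfl fun j _ => ?_
    ring
  have hmeas : Measurable (fun p : (Fin k → EuclideanSpace ℝ (Fin d)) ×
      (Fin k → EuclideanSpace ℝ (Fin d)) => ∑ i, logRelNorm (p.1 i) * scoreAt i p.2) := by
    fun_prop
  have hLp : MemLp (fun p : (Fin k → EuclideanSpace ℝ (Fin d)) ×
      (Fin k → EuclideanSpace ℝ (Fin d)) => ∑ i, logRelNorm (p.1 i) * scoreAt i p.2) 2 M := by
    rw [memLp_two_iff_integrable_sq hmeas.aestronglyMeasurable]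
    simp_rw [hexpand]
    exact integrable_finsetSum _ fun i _ => integrable_finsetSum _ fun j _ => hprod i j
  refine ⟨Real.le_sqrt_of_sq_le ((sq_integral_abs_le hLp).trans ?_),
    (hLp.integrable (by norm_num)).abs⟩
  simp_rw [hexpand]
  rw [integral_finsetSum _ fun i _ => integrable_finsetSum _ fun j _ => hprod i j]
  simp_rw [integral_finsetSum _ fun j _ => hprod _ j]
  -- No decorrelation of the scores is used, only xy ≤ (x² + y²) / 2.
  have hscore : ∀ i j : Fin k, ∫ z, scoreAt i z * scoreAt j z ∂(gaussianVectors k d) ≤ 8 * k := by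
    intro i j
    obtain ⟨Ii, hi⟩ := scoreAt_second_moment hk hkd i
    obtain ⟨Ij, hj⟩ := scoreAt_second_moment hk hkd j
    have : ∫ z, scoreAt i z * scoreAt j z ∂(gaussianVectors k d) ≤
        ∫ z, (scoreAt i z ^ 2 + scoreAt j z ^ 2) / 2 ∂(gaussianVectors k d) := by
      refine integral_mono (hs i j) ((Ii.add Ij).div_const 2) fun z => ?_
      simp only
      nlinarith [sq_nonneg (scoreAt i z - scoreAt j z)]
    rw [integral_div, integral_add Ii Ij] at this
    linarith
  have hk' : (2 : ℝ) ≤ k := by exact_mod_cast hk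
  have hd' : (2 * k + 20 : ℝ) ≤ d := by exact_mod_cast hkd
  have hd2 : (0 : ℝ) < (d : ℝ) - 2 := by linarith
  have hterm : ∀ i j : Fin k, ∫ p, (logRelNorm (p.1 i) * logRelNorm (p.1 j)) *
      (scoreAt i p.2 * scoreAt j p.2) ∂M ≤
      ((if i = j then 1 / (2 * ((d : ℝ) - 2)) else 0) + (1 / ((d : ℝ) - 2)) ^ 2) * (8 * k) := by
    intro i j
    obtain ⟨h0, h1⟩ := integral_logRelNorm_mul_le (d := d) (by omega) i j
    rw [integral_prod_mul (fun ζ : Fin k → EuclideanSpace ℝ (Fin d) =>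
      logRelNorm (ζ i) * logRelNorm (ζ j)) (fun z => scoreAt i z * scoreAt j z)]
    exact (mul_le_mul_of_nonneg_left (hscore i j) h0).trans
      (mul_le_mul_of_nonneg_right h1 (by positivity))
  refine (Finset.sum_le_sum fun i _ => Finset.sum_le_sum fun j _ => hterm i j).trans ?_
  simp only [← Finset.sum_mul, Finset.sum_add_distrib, Finset.sum_ite_eq, Finset.mem_univ, if_true,
    Finset.sum_const, Finset.card_univ, Fintype.card_fin, nsmul_eq_mul]
  have hx : (k : ℝ) * (1 / (d - 2)) ≤ 1 / 2 := by
    rw [mul_one_div, div_le_iff₀ hd2]; linarith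
  have hy : 1 / ((d : ℝ) - 2) ≤ 2 / d := by
    rw [div_le_div_iff₀ hd2 (by linarith)]; linarith
  have hy0 : 0 ≤ 1 / ((d : ℝ) - 2) := (one_div_pos.2 hd2).le
  set y := 1 / ((d : ℝ) - 2) with hydef
  have h2 : 1 / (2 * ((d : ℝ) - 2)) = y / 2 := by rw [hydef]; field_simp
  rw [h2]
  calc ((k : ℝ) * (y / 2) + k * k * y ^ 2) * (8 * k)
      = 8 * k ^ 2 * y * (1 / 2 + k * y) := by ring
    _ ≤ 8 * k ^ 2 * y * 1 := by gcongr; linarith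
    _ ≤ 8 * k ^ 2 * (2 / d) * 1 := by gcongr
    _ = 16 * (k ^ 2 / d) := by ring

lemma measurable_scaledGram :
    Measurable (scaledGram : (Fin k → EuclideanSpace ℝ (Fin d)) → UpperPairs k → ℝ) := by
  unfold scaledGram
  fun_prop

/-- Quantitative comparison of the laws of the two Gram matrices. -/
theorem tvDist_sphericalGram_scaledGram_le (hk : 2 ≤ k) (hkd : 2 * k + 20 ≤ d) :
    tvDist ((gaussianVectors k d).map sphericalGram) ((gaussianVectors k d).map scaledGram) ≤
      Real.sqrt (16 * (k ^ 2 / d)) := by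
  have hX := measurable_sphericalGram (k := k) (d := d)
  have hY := measurable_scaledGram (k := k) (d := d)
  have : IsProbabilityMeasure ((gaussianVectors k d).map sphericalGram) :=
    Measure.isProbabilityMeasure_map hX.aemeasurable
  have : IsProbabilityMeasure ((gaussianVectors k d).map scaledGram) :=
    Measure.isProbabilityMeasure_map hY.aemeasurable
  refine tvDist_le_of_forall_contDiff fun φ hφ hφc hφ1 => ?_
  obtain ⟨hB, hI⟩ := integral_abs_sum_logRelNorm_mul_scoreAt_le hk hkd
  have hφm : Measurable φ := hφ.continuous.measurable
  have hφb : ∀ x, ‖φ x‖ ≤ 1 := fun x => by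
    rw [Real.norm_of_nonneg (hφ1 x).1]; exact (hφ1 x).2
  rw [integral_map hX.aemeasurable hφm.aestronglyMeasurable,
    integral_map hY.aemeasurable hφm.aestronglyMeasurable]
  have hmp := measurePreserving_withNormOf_pi (k := k) (d := d) (by omega)
  have hint : Integrable (fun z => φ (scaledGram z)) (gaussianVectors k d) :=
    Integrable.of_bound (hφm.comp hY).aestronglyMeasurable 1 (ae_of_all _ fun z => hφb _)
  have hint2 : Integrable (fun p : (Fin k → EuclideanSpace ℝ (Fin d)) ×
      (Fin k → EuclideanSpace ℝ (Fin d)) => φ (scaledGram fun i => withNormOf (p.1 i, p.2 i)))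
      ((gaussianVectors k d).prod (gaussianVectors k d)) := hmp.integrable_comp_of_integrable hint
  have hlaw : ∫ z, φ (scaledGram z) ∂(gaussianVectors k d) =
      ∫ ζ, ∫ z, φ (scaledGram fun i => withNormOf (ζ i, z i)) ∂(gaussianVectors k d)
        ∂(gaussianVectors k d) := by
    rw [← integral_prod (fun p : (Fin k → EuclideanSpace ℝ (Fin d)) ×
      (Fin k → EuclideanSpace ℝ (Fin d)) => φ (scaledGram fun i => withNormOf (p.1 i, p.2 i))) hint2]
    conv_lhs => rw [← hmp.map_eq]
    rw [integral_map hmp.aemeasurable (by exact (hφm.comp hY).aestronglyMeasurable)]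
  -- For fixed ζ the inner integral is a deterministic row scaling, so the path estimate applies
  -- before averaging over ζ.
  rw [abs_sub_comm, hlaw]
  refine le_trans ?_ hB
  rw [integral_prod _ hI]
  have hconst : ∫ z, φ (sphericalGram z) ∂(gaussianVectors k d) =
      ∫ _ζ, ∫ z, φ (sphericalGram z) ∂(gaussianVectors k d) ∂(gaussianVectors k d) := by simp
  rw [hconst, ← integral_sub hint2.integral_prod_left (integrable_const _)]
  refine abs_integral_le_integral_abs.trans (integral_mono_ae
    (hint2.integral_prod_left.sub (integrable_const _)).abs hI.integral_prod_left ?_)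
  filter_upwards [ae_ne_zero_gaussianVectors (k := k) (d := d) (by omega)] with ζ hζ
  have := abs_integral_scaleEntries_sub_le hk hkd hφ hφc hφ1 (fun i => logRelNorm (ζ i))
  simp_rw [fun z => scaledGram_withNormOf (by omega : 0 < d) ζ z hζ]
  exact this

end Averaging

/-! ### The limit -/

theorem proposition5p1
    (k d : ℕ → ℕ)
    (hk : Tendsto k atTop atTop)
    (hkd : (fun n => ((k n : ℝ)) ^ 2) =o[atTop] (fun n => (d n : ℝ)))
    {Ω : ℕ → Type*} [∀ n, MeasurableSpace (Ω n)]
    (P : ∀ n, Measure (Ω n)) [∀ n, IsProbabilityMeasure (P n)]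
    (Z : ∀ n, Fin (k n) → Ω n → EuclideanSpace ℝ (Fin (d n)))
    (hlaw : ∀ n i, HasLaw (Z n i) (stdGaussian (EuclideanSpace ℝ (Fin (d n)))) (P n))
    (hindep : ∀ n, iIndepFun (Z n) (P n)) :
    Tendsto
      (fun n => tvDist
        ((P n).map (fun ω => sphericalGram (fun i => Z n i ω)))
        ((P n).map (fun ω => scaledGram (fun i => Z n i ω))))
      atTop (𝓝 0) := by
  have hjoint : ∀ n, HasLaw (fun ω i => Z n i ω) (gaussianVectors (k n) (d n)) (P n) := fun n =>
    (hindep n).hasLaw_pi (hlaw n)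
  have hmapX : ∀ n, (P n).map (fun ω => sphericalGram (fun i => Z n i ω)) =
      (gaussianVectors (k n) (d n)).map sphericalGram := fun n => by
    rw [← (hjoint n).map_eq, AEMeasurable.map_map_of_aemeasurable
      measurable_sphericalGram.aemeasurable (hjoint n).aemeasurable]
    rfl
  have hmapY : ∀ n, (P n).map (fun ω => scaledGram (fun i => Z n i ω)) =
      (gaussianVectors (k n) (d n)).map scaledGram := fun n => by
    rw [← (hjoint n).map_eq, AEMeasurable.map_map_of_aemeasurable
      measurable_scaledGram.aemeasurable (hjoint n).aemeasurable]
    rfl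
  simp_rw [hmapX, hmapY]
  have hlim : Tendsto (fun n => Real.sqrt (16 * ((k n : ℝ) ^ 2 / d n))) atTop (𝓝 0) := by
    have := ((hkd.tendsto_div_nhds_zero).const_mul 16).sqrt
    simpa using this
  have hlarge : ∀ᶠ n in atTop, 2 ≤ k n ∧ 2 * k n + 20 ≤ d n := by
    -- Once k ≥ 22, d ≥ k² ≥ 22k ≥ 2k + 20.
    filter_upwards [hk.eventually_ge_atTop 22, hkd.def one_pos] with n h1 h2
    refine ⟨by omega, ?_⟩
    simp only [norm_pow, Real.norm_natCast, one_mul] at h2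
    have h3 : k n ^ 2 ≤ d n := by exact_mod_cast h2
    nlinarith
  refine squeeze_zero' (Eventually.of_forall fun n => ?_) ?_ hlim
  · exact Real.iSup_nonneg fun A => abs_nonneg _
  · filter_upwards [hlarge] with n hn
    exact tvDist_sphericalGram_scaledGram_le hn.1 hn.2
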